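/- Let $F_3=F(\beta_1,\beta_2,\beta_3)$ and $F_2=F(\alpha_1,\alpha_2)$ be free groups, and let $F_3\rtimes F_2$ be the semidirect product in which $\alpha_1,\alpha_2$ act on $F_3$ by the automorphisms given by the relations $$\begin{aligned} R1.\ &\alpha_1\beta_1\alpha_1^{-1}=(\beta_2\beta_1)^{-1}\beta_1(\beta_2\beta_1), & R4.\ &\alpha_2\beta_1\alpha_2^{-1}=(\beta_3\beta_1)^{-1}\beta_1(\beta_3\beta_1),\\ R2.\ &\alpha_1\beta_2\alpha_1^{-1}=\beta_1^{-1}\beta_2\beta_1, & R5.\ &\alpha_2\beta_2\alpha_2^{-1}=(\beta_3\beta_1)^{-1}(\beta_1\beta_3)\beta_2(\beta_1\beta_3)^{-1}(\beta_3\beta_1),\\ R3.\ &\alpha_1\beta_3\alpha_1^{-1}=\beta_3, & R6.\ &\alpha_2\beta_3\alpha_2^{-1}=\beta_1^{-1}\beta_3\beta_1. \end{aligned}$$ Let $X$ be the presentation $2$-complex of the presentation with generators $\alpha_1,\alpha_2,\beta_1,\beta_2,\beta_3$ and relations $R1,\dots,R6$: it has one $0$-cell $p$, five $1$-cells attached to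 $p$ as loops, one for each generator, and six $2$-cells, where the $2$-cell of a relation $u=v$ is attached along the loop that spells $uv^{-1}$. Then $X$ is a model for the classifying space $B(F_3\rtimes F_2)$: $X$ is the quotient of a contractible space by a free and properly discontinuous action of $F_3\rtimes F_2$ (every point has a neighbourhood whose translates are pairwise disjoint). Equivalently, $\pi_1(X,p)\cong F_3\rtimes F_2$ and the universal cover of $X$ (that is, every simply connected covering space of $X$) is contractible. -/

import Mathlib

/-! ### The group `F₃ ⋊ F₂` -/

/-- The images `α_{i+1} β_{j+1} α_{i+1}⁻¹` in the free group on `β₁, β₂, β₃`: the right-hand sides of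
the six relations `R1, …, R6`. Here `b 0, b 1, b 2` stand for `β₁, β₂, β₃`. -/
def conjBeta (i : Fin 2) (j : Fin 3) : FreeGroup (Fin 3) :=
  let b : Fin 3 → FreeGroup (Fin 3) := FreeGroup.of
  match i, j with
  | 0, 0 => (b 1 * b 0)⁻¹ * b 0 * (b 1 * b 0)
  | 0, 1 => (b 0)⁻¹ * b 1 * b 0
  | 0, 2 => b 2
  | 1, 0 => (b 2 * b 0)⁻¹ * b 0 * (b 2 * b 0)
  | 1, 1 => (b 2 * b 0)⁻¹ * (b 0 * b 2) * b 1 * (b 0 * b 2)⁻¹ * (b 2 * b 0)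
  | 1, 2 => (b 0)⁻¹ * b 2 * b 0

/-- The values on the generators of the inverse automorphisms. -/
def conjBetaInv (i : Fin 2) (j : Fin 3) : FreeGroup (Fin 3) :=
  let b : Fin 3 → FreeGroup (Fin 3) := FreeGroup.of
  match i, j with
  | 0, 0 => (b 1 * b 0) * b 0 * (b 1 * b 0)⁻¹
  | 0, 1 => (b 1 * b 0) * b 1 * (b 1 * b 0)⁻¹
  | 0, 2 => b 2
  | 1, 0 => (b 2 * b 0) * b 0 * (b 2 * b 0)⁻¹
  | 1, 1 => (b 2 * b 0) * (b 0 * b 2)⁻¹ * b 1 * (b 0 * b 2) * (b 2 * b 0)⁻¹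
  | 1, 2 => (b 2 * b 0) * b 2 * (b 2 * b 0)⁻¹

/-- The automorphism of `F(β₁, β₂, β₃)` by which `α_{i+1}` acts. -/
def alphaAut (i : Fin 2) : MulAut (FreeGroup (Fin 3)) :=
  MonoidHom.toMulEquiv (FreeGroup.lift (conjBeta i)) (FreeGroup.lift (conjBetaInv i))
    (by
      ext j
      fin_cases i <;> fin_cases j <;> simp [conjBeta, conjBetaInv] <;> group)
    (by
      ext j
      fin_cases i <;> fin_cases j <;> simp [conjBeta, conjBetaInv] <;> group)

/-- The action of `F(α₁, α₂)` on `F(β₁, β₂, β₃)`. -/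
def alphaAction : FreeGroup (Fin 2) →* MulAut (FreeGroup (Fin 3)) :=
  FreeGroup.lift alphaAut

/-- The group `F₃ ⋊ F₂ = F(β₁, β₂, β₃) ⋊ F(α₁, α₂)`. -/
abbrev F3F2 : Type := FreeGroup (Fin 3) ⋊[alphaAction] FreeGroup (Fin 2)

/-- The relators of the presentation of `F₃ ⋊ F₂` on the generators `α₁, α₂` (left summand) and
`β₁, β₂, β₃` (right summand), one for each of the relations `R1, …, R6`: the left-hand side
`α_{i+1} β_{j+1} α_{i+1}⁻¹` times the inverse of the right-hand side. -/
def relatorF3F2 (r : Fin 2 × Fin 3) : FreeGroup (Fin 2 ⊕ Fin 3) :=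
  FreeGroup.of (Sum.inl r.1) * FreeGroup.of (Sum.inr r.2) * (FreeGroup.of (Sum.inl r.1))⁻¹ *
    (FreeGroup.map Sum.inr (conjBeta r.1 r.2))⁻¹

/-! ### Presentation complexes -/

/-- In the disjoint union of a point and of a copy of `[0, 1]` for each `s : S`, both endpoints of
each interval are glued to the point. -/
inductive BouquetRel (S : Type*) :
    Unit ⊕ (Σ _ : S, unitInterval) → Unit ⊕ (Σ _ : S, unitInterval) → Prop
  | left (s : S) : BouquetRel S (Sum.inl ()) (Sum.inr ⟨s, 0⟩)
  | right (s : S) : BouquetRel S (Sum.inl ()) (Sum.inr ⟨s, 1⟩)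

/-- The bouquet of circles indexed by `S`: one `0`-cell and one `1`-cell for each `s : S`. -/
def Bouquet (S : Type*) : Type _ := Quot (BouquetRel S)

namespace Bouquet

variable {S : Type*}

instance : TopologicalSpace (Bouquet S) := inferInstanceAs (TopologicalSpace (Quot _))

/-- The `0`-cell. -/
def base : Bouquet S := Quot.mk _ (Sum.inl ())

/-- The loop that runs once along the `1`-cell of `s`. -/
def loop (s : S) : Path (base : Bouquet S) base where
  toFun t := Quot.mk _ (Sum.inr ⟨s, t⟩)
  continuous_toFun := continuous_quot_mk.comp (continuous_inr.comp continuous_sigmaMk)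
  source' := (Quot.sound (BouquetRel.left s)).symm
  target' := (Quot.sound (BouquetRel.right s)).symm

/-- The loop of a letter: `(s, true)` stands for `s` and `(s, false)` for `s⁻¹`. -/
noncomputable def letterLoop (a : S × Bool) : Path (base : Bouquet S) base :=
  if a.2 then loop a.1 else (loop a.1).symm

/-- The loop that reads a word from left to right. -/
noncomputable def wordLoop : List (S × Bool) → Path (base : Bouquet S) base
  | [] => Path.refl base
  | [a] => letterLoop a
  | a :: b :: w => (letterLoop a).trans (wordLoop (b :: w))

end Bouquet

/-- The point `exp (2 π i t)` on the boundary of the closed unit disc. -/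
noncomputable def discBoundary (t : unitInterval) : Metric.closedBall (0 : ℂ) 1 :=
  ⟨Circle.exp (2 * Real.pi * t), mem_closedBall_zero_iff.2 (Circle.norm_coe _).le⟩

/-- In the disjoint union of the bouquet of circles and of a closed disc for each `i : ι`, the
boundary of the `i`-th disc is glued along the loop that reads the reduced word of the `i`-th
relator. -/
inductive AttachRel {S ι : Type*} [DecidableEq S] (rel : ι → FreeGroup S) :
    Bouquet S ⊕ (Σ _ : ι, Metric.closedBall (0 : ℂ) 1) →
      Bouquet S ⊕ (Σ _ : ι, Metric.closedBall (0 : ℂ) 1) → Prop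
  | glue (i : ι) (t : unitInterval) :
      AttachRel rel (Sum.inl (Bouquet.wordLoop (rel i).toWord t)) (Sum.inr ⟨i, discBoundary t⟩)

/-- The presentation `2`-complex of the presentation with generators `S` and relators `rel`: one
`0`-cell, one `1`-cell for each generator and one `2`-cell for each relator. -/
def PresentationComplex {S ι : Type*} [DecidableEq S] (rel : ι → FreeGroup S) : Type _ :=
  Quot (AttachRel rel)

namespace PresentationComplex

variable {S ι : Type*} [DecidableEq S]

instance (rel : ι → FreeGroup S) : TopologicalSpace (PresentationComplex rel) :=
  inferInstanceAs (TopologicalSpace (Quot _))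

/-- The `0`-cell. -/
def base (rel : ι → FreeGroup S) : PresentationComplex rel := Quot.mk _ (Sum.inl Bouquet.base)

end PresentationComplex

/-- The presentation `2`-complex of `F₃ ⋊ F₂`, with one `0`-cell, five `1`-cells and six
`2`-cells. -/
abbrev complexF3F2 : Type := PresentationComplex relatorF3F2

/-! ### Classifying spaces and universal covers -/

/-- `X` (a CW complex) is a model for the classifying space `BG` of the discrete group `G`: it is the
quotient of a contractible space by a free and properly discontinuous action of `G` (each point has
a neighbourhood whose translates are pairwise disjoint). -/
def IsModelOfClassifyingSpace (G : Type*) [Group G] (X : Type) [TopologicalSpace X] : Prop :=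
  ∃ (E : Type) (_ : TopologicalSpace E) (_ : MulAction G E) (p : E → X),
    ContractibleSpace E ∧ IsQuotientCoveringMap p G

/-- `p : E → X` is a universal cover: a covering map with simply connected total space. -/
def IsUniversalCover {E X : Type*} [TopologicalSpace E] [TopologicalSpace X] (p : E → X) : Prop :=
  SimplyConnectedSpace E ∧ IsCoveringMap p

open Topology

/-! ### The closed disc in polar coordinates -/

/-! The contractible space is the Cayley complex of G = F₃ ⋊ F₂: a vertex for each element of G, an
edge from g to gs for each generator s, and a disc for each g and each relator, attached along the
path that reads the relator from g. Left translation by G is free and properly discontinuous, and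
the quotient is X (`isQuotientCoveringMap_toPresentationComplex`). Once this complex is known to be
contractible, covering space theory gives π₁(X) ≅ G. Since X is locally path-connected, every simply
connected cover is homeomorphic to the Cayley complex.

Contractibility comes from the geometry of the relations. Each element is uniquely vh with v in F₂
and h in F₃, so the vertices and β-edges form one Cayley tree of F₃ over each v. As α_i(h) α_i = α_i
h in G, where α_i(h) is the image of h under the automorphism, the α_i-edges join the vertex α_i(h)
over v to the vertex h over vα_i. A face has one edge of the tree over vα_i on one side and,
opposite to it, the path in the tree over v that spells its image. So the strip between the trees
over v and vα_i is the mapping cylinder of a map of trees. The whole complex is assembled from such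
cylinders along trees, in the pattern of the Cayley tree of F₂.

The assembly is carried out with extensors for compact Hausdorff spaces. Embedded arcs and discs are
extensors by Tietze's theorem (`IsExtensor.range`). Extensors can be glued along extensors
(`IsExtensor.union`), and directed unions of subcomplexes that are extensors are extensors, because
a compact set meets only finitely many open cells (`isExtensor_realize_iUnion`). Growing the trees
(`isFilled_fiber`), the strips (`isFilled_strip`) and the tree of cosets (`isFilled_cosets`) one
piece at a time shows that the complex is an extensor. A null-homotopy of the identity is then found
skeleton by skeleton (`contractibleSpace_of_isExtensor`). -/

lemma exists_discBoundary_eq (z : Metric.closedBall (0 : ℂ) 1) (hz : ‖(z : ℂ)‖ = 1) :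
    ∃ t : unitInterval, discBoundary t = z := by
  have h2 : 0 < 2 * Real.pi := Real.two_pi_pos
  let c : Circle := ⟨z, mem_sphere_zero_iff_norm.2 hz⟩
  -- `Complex.arg` lies in (-π, π]; it is shifted into [0, 2π) so that division by 2π gives a
  -- parameter in the unit interval.
  set x := toIcoMod h2 0 (Complex.arg z)
  have hx : x ∈ Set.Ico 0 (0 + 2 * Real.pi) := toIcoMod_mem_Ico h2 0 _
  refine ⟨⟨x / (2 * Real.pi), div_nonneg hx.1 h2.le, (div_le_one h2).2 (by linarith [hx.2])⟩, ?_⟩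
  apply Subtype.ext
  change ((Circle.exp (2 * Real.pi * (x / (2 * Real.pi))) : Circle) : ℂ) = c
  congr 1
  rw [mul_div_cancel₀ _ h2.ne', ← Circle.exp_arg c]
  refine Circle.exp_eq_exp.2 ?_
  refine ⟨-toIcoDiv h2 0 (Complex.arg z), ?_⟩
  have := toIcoMod_add_toIcoDiv_zsmul h2 0 (Complex.arg z)
  simp only [zsmul_eq_mul] at this
  push_cast
  change x = Complex.arg z + _
  linarith

lemma norm_discBoundary (t : unitInterval) : ‖(discBoundary t : ℂ)‖ = 1 := Circle.norm_coe _

lemma continuous_discBoundary : Continuous discBoundary := by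
  unfold discBoundary
  fun_prop

lemma discBoundary_eq_iff {s t : unitInterval} :
    discBoundary s = discBoundary t ↔ s = t ∨ s = 0 ∧ t = 1 ∨ s = 1 ∧ t = 0 := by
  have h2 : 0 < 2 * Real.pi := Real.two_pi_pos
  constructor
  · intro h
    have h' : Circle.exp (2 * Real.pi * s) = Circle.exp (2 * Real.pi * t) :=
      Circle.ext (congrArg (Subtype.val (p := (· ∈ Metric.closedBall (0 : ℂ) 1))) h)
    obtain ⟨m, hm⟩ := Circle.exp_eq_exp.1 h'
    have hm' : (s : ℝ) = t + m := by
      apply mul_left_cancel₀ h2.ne'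
      linarith
    have hs := s.2
    have ht := t.2
    have h1 : (m : ℝ) ≤ 1 := by linarith [hs.2, ht.1]
    have h3 : (-1 : ℝ) ≤ m := by linarith [hs.1, ht.2]
    have h1' : m ≤ 1 := by exact_mod_cast h1
    have h3' : -1 ≤ m := by exact_mod_cast h3
    obtain rfl | rfl | rfl : m = -1 ∨ m = 0 ∨ m = 1 := by omega
    · right; left
      constructor <;> apply Subtype.ext <;> push_cast at hm' ⊢ <;> linarith [hs.1, ht.2]
    · left
      apply Subtype.ext
      simpa using hm'
    · right; right
      constructor <;> apply Subtype.ext <;> push_cast at hm' ⊢ <;> linarith [hs.2, ht.1]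
  · rintro (rfl | ⟨rfl, rfl⟩ | ⟨rfl, rfl⟩) <;> simp [discBoundary]

/-- A parameter `t` for which the point `z` of the disc lies on the radius through
`discBoundary t`. -/
noncomputable def discAngle (z : Metric.closedBall (0 : ℂ) 1) : unitInterval :=
  open Classical in
  if h : ∃ t : unitInterval, (z : ℂ) = ‖(z : ℂ)‖ * discBoundary t then h.choose else 0

lemma norm_mul_discBoundary_discAngle (z : Metric.closedBall (0 : ℂ) 1) :
    (‖(z : ℂ)‖ * discBoundary (discAngle z) : ℂ) = z := by
  have h : ∃ t : unitInterval, (z : ℂ) = ‖(z : ℂ)‖ * discBoundary t := by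
    by_cases hz : (z : ℂ) = 0
    · exact ⟨0, by simp [hz]⟩
    have hz' : ‖(z : ℂ)‖ ≠ 0 := norm_ne_zero_iff.2 hz
    have h1 : ‖(z : ℂ) / ‖(z : ℂ)‖‖ = 1 := by
      rw [norm_div, Complex.norm_real, norm_norm, div_self hz']
    obtain ⟨t, ht⟩ := exists_discBoundary_eq ⟨(z : ℂ) / ‖(z : ℂ)‖, mem_closedBall_zero_iff.2 h1.le⟩ h1
    refine ⟨t, ?_⟩
    rw [ht]
    have : (‖(z : ℂ)‖ : ℂ) ≠ 0 := by exact_mod_cast hz'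
    field_simp
  rw [discAngle, dif_pos h]
  exact h.choose_spec.symm

lemma discBoundary_discAngle {z : Metric.closedBall (0 : ℂ) 1} (hz : ‖(z : ℂ)‖ = 1) :
    discBoundary (discAngle z) = z := by
  apply Subtype.ext
  have := norm_mul_discBoundary_discAngle z
  rwa [hz, Complex.ofReal_one, one_mul] at this

/-- On the boundary circle the parameter chosen by `discAngle` is ambiguous only between 0 and 1,
where a loop takes the same value. -/
lemma apply_discAngle_discBoundary {Z : Type*} (f : unitInterval → Z) (hf : f 0 = f 1)
    (t : unitInterval) : f (discAngle (discBoundary t)) = f t := by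
  have := discBoundary_discAngle (norm_discBoundary t)
  rcases discBoundary_eq_iff.1 this with h | ⟨h, h'⟩ | ⟨h, h'⟩
  · rw [h]
  · rw [h, h', hf]
  · rw [h, h', hf]

/-- A loop, considered as a continuous map on the boundary circle of the disc. -/
lemma continuousOn_comp_discAngle {Z : Type*} [TopologicalSpace Z] {f : unitInterval → Z}
    (hc : Continuous f) (hf : f 0 = f 1) :
    ContinuousOn (fun z ↦ f (discAngle z)) {z | ‖(z : ℂ)‖ = 1} := by
  rw [continuousOn_iff_isClosed]
  intro F hF
  refine ⟨discBoundary '' (f ⁻¹' F), ?_, ?_⟩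
  · exact ((hF.preimage hc).isCompact.image continuous_discBoundary).isClosed
  · ext z
    constructor
    · rintro ⟨h1, h2⟩
      exact ⟨⟨discAngle z, h1, discBoundary_discAngle h2⟩, h2⟩
    · rintro ⟨⟨t, ht, rfl⟩, h2⟩
      refine ⟨?_, h2⟩
      change f _ ∈ F
      rw [apply_discAngle_discBoundary f hf]
      exact ht

/-- The point of the disc with polar coordinates `r` and `2 π t`. -/
noncomputable def discPolar (x : unitInterval × unitInterval) : Metric.closedBall (0 : ℂ) 1 :=
  ⟨(x.1 : ℝ) * discBoundary x.2, mem_closedBall_zero_iff.2 (by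
    rw [norm_mul, norm_discBoundary, mul_one, Complex.norm_real, Real.norm_eq_abs,
      abs_of_nonneg x.1.2.1]
    exact x.1.2.2)⟩

lemma norm_discPolar (x : unitInterval × unitInterval) : ‖(discPolar x : ℂ)‖ = x.1 := by
  rw [discPolar, norm_mul, norm_discBoundary, mul_one, Complex.norm_real, Real.norm_eq_abs,
      abs_of_nonneg x.1.2.1]

lemma continuous_discPolar : Continuous discPolar := by
  unfold discPolar
  have := continuous_discBoundary
  fun_prop

/-- Since `discAngle` is not continuous, continuity of functions defined through it is tested on the
square of polar coordinates. -/
lemma isQuotientMap_discPolar : IsQuotientMap discPolar := by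
  refine continuous_discPolar.isClosedMap.isQuotientMap continuous_discPolar fun z ↦ ?_
  refine ⟨(⟨‖(z : ℂ)‖, norm_nonneg _, mem_closedBall_zero_iff.1 z.2⟩, discAngle z), ?_⟩
  exact Subtype.ext (norm_mul_discBoundary_discAngle z)

/-- Away from the centre the angle is determined up to the identification of 0 and 1; at the centre
the factor r = 0 hides the arbitrary choice. -/
lemma mul_apply_discAngle_discPolar (f : unitInterval → ℝ) (hf : f 0 = f 1)
    (x : unitInterval × unitInterval) :
    (x.1 : ℝ) * f (discAngle (discPolar x)) = x.1 * f x.2 := by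
  by_cases hx : (x.1 : ℝ) = 0
  · simp [hx]
  have h := norm_mul_discBoundary_discAngle (discPolar x)
  rw [norm_discPolar] at h
  have h' : (discBoundary (discAngle (discPolar x)) : ℂ) = discBoundary x.2 :=
    mul_left_cancel₀ (by exact_mod_cast hx) h
  rw [← apply_discAngle_discBoundary f hf x.2, ← apply_discAngle_discBoundary f hf (discAngle _),
    Subtype.ext h']

/-- The conical extension of a function on the boundary circle is continuous. -/
lemma continuous_norm_mul_discAngle {f : unitInterval → ℝ} (hc : Continuous f) (hf : f 0 = f 1) :
    Continuous fun z : Metric.closedBall (0 : ℂ) 1 ↦ ‖(z : ℂ)‖ * f (discAngle z) := by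
  rw [isQuotientMap_discPolar.continuous_iff]
  have : (fun z : Metric.closedBall (0 : ℂ) 1 ↦ ‖(z : ℂ)‖ * f (discAngle z)) ∘ discPolar =
      fun x ↦ (x.1 : ℝ) * f x.2 := by
    funext x
    simp only [Function.comp_apply, norm_discPolar]
    exact mul_apply_discAngle_discPolar f hf x
  rw [this]
  fun_prop

/-! ### Cayley graphs and Cayley complexes -/

section Cayley

variable {G S ι : Type} [Group G]

/-- Gluing of the ends of the edges of the Cayley graph. -/
inductive CayleyGraphRel (φ : FreeGroup S →* G) :
    (Σ _ : G, Unit) ⊕ (Σ _ : G × S, unitInterval) →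
      (Σ _ : G, Unit) ⊕ (Σ _ : G × S, unitInterval) → Prop
  | left (g : G) (s : S) : CayleyGraphRel φ (Sum.inl ⟨g, ()⟩) (Sum.inr ⟨(g, s), 0⟩)
  | right (g : G) (s : S) :
      CayleyGraphRel φ (Sum.inl ⟨g * φ (FreeGroup.of s), ()⟩) (Sum.inr ⟨(g, s), 1⟩)

/-- The Cayley graph of a group with respect to the images of the generators `S`, as a
topological space. -/
def CayleyGraph (φ : FreeGroup S →* G) : Type := Quot (CayleyGraphRel φ)

namespace CayleyGraph

variable (φ : FreeGroup S →* G)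

instance : TopologicalSpace (CayleyGraph φ) := inferInstanceAs (TopologicalSpace (Quot _))

/-- The vertex of a group element. -/
def vertex (g : G) : CayleyGraph φ := Quot.mk _ (Sum.inl ⟨g, ()⟩)

/-- The edge that starts at `g` and is labelled by `s`. -/
def edge (g : G) (s : S) : Path (vertex φ g) (vertex φ (g * φ (FreeGroup.of s))) where
  toFun t := Quot.mk _ (Sum.inr ⟨(g, s), t⟩)
  continuous_toFun := continuous_quot_mk.comp (continuous_inr.comp continuous_sigmaMk)
  source' := (Quot.sound (CayleyGraphRel.left g s)).symm
  target' := (Quot.sound (CayleyGraphRel.right g s)).symm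

variable {φ}

@[elab_as_elim]
lemma ind {P : CayleyGraph φ → Prop} (h0 : ∀ g, P (vertex φ g))
    (h1 : ∀ g s t, P (edge φ g s t)) (x : CayleyGraph φ) : P x := by
  obtain ⟨⟨g, ⟨⟩⟩ | ⟨⟨g, s⟩, t⟩⟩ := x
  · exact h0 g
  · exact h1 g s t

/-- Functions on the Cayley graph from functions on the vertices and the edges. -/
def lift {Z : Type*} (f0 : G → Z) (f1 : G → S → unitInterval → Z)
    (h0 : ∀ g s, f1 g s 0 = f0 g) (h1 : ∀ g s, f1 g s 1 = f0 (g * φ (FreeGroup.of s))) :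
    CayleyGraph φ → Z :=
  Quot.lift (Sum.elim (fun x ↦ f0 x.1) (fun x ↦ f1 x.1.1 x.1.2 x.2)) (by
    rintro _ _ (⟨g, s⟩ | ⟨g, s⟩)
    · exact (h0 g s).symm
    · exact (h1 g s).symm)

lemma continuous_of_cells {Z : Type*} [TopologicalSpace Z] {f : CayleyGraph φ → Z}
    (hf : ∀ g s, Continuous fun t ↦ f (edge φ g s t)) : Continuous f := by
  refine isQuotientMap_quot_mk.continuous_iff.2 (continuous_sum_dom.2 ⟨?_, ?_⟩)
  · exact continuous_sigma fun g ↦ continuous_of_discreteTopology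
  · exact continuous_sigma fun x ↦ hf x.1 x.2

lemma isClosed_of_cells {A : Set (CayleyGraph φ)}
    (hA : ∀ g s, IsClosed (edge φ g s ⁻¹' A)) : IsClosed A := by
  have hq : IsQuotientMap (Quot.mk (CayleyGraphRel φ)) := isQuotientMap_quot_mk
  refine hq.isClosed_preimage.1 (isClosed_sum_iff.2 ⟨?_, ?_⟩)
  · exact isClosed_sigma_iff.2 fun g ↦ isClosed_discrete _
  · exact isClosed_sigma_iff.2 fun x ↦ hA x.1 x.2

/-- The edge path of a letter: `(s, true)` stands for `s` and `(s, false)` for `s⁻¹`. -/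
def letterPath (φ : FreeGroup S →* G) (g : G) :
    (a : S × Bool) → Path (vertex φ g) (vertex φ (g * φ (FreeGroup.mk [a])))
  | (s, true) => edge φ g s
  | (s, false) => ((edge φ (g * φ (FreeGroup.mk [(s, false)])) s).symm).cast (by
      congr 1
      rw [mul_assoc, ← map_mul]
      change g = g * φ ((FreeGroup.of s)⁻¹ * FreeGroup.of s)
      simp) rfl

/-- The edge path that starts at `g` and reads a word from left to right. -/
noncomputable def wordPath (φ : FreeGroup S →* G) :
    (g : G) → (w : List (S × Bool)) → Path (vertex φ g) (vertex φ (g * φ (FreeGroup.mk w)))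
  | g, [] => (Path.refl (vertex φ g)).cast rfl (by rw [← FreeGroup.one_eq_mk, map_one, mul_one])
  | g, [a] => letterPath φ g a
  | g, a :: b :: w =>
      ((letterPath φ g a).trans (wordPath φ (g * φ (FreeGroup.mk [a])) (b :: w))).cast rfl (by
        rw [mul_assoc, ← map_mul, FreeGroup.mul_mk, List.singleton_append])

/-- The projection of the Cayley graph to the bouquet of circles. -/
def toBouquet : CayleyGraph φ → Bouquet S :=
  lift (fun _ ↦ Bouquet.base) (fun _ s t ↦ Bouquet.loop s t) (fun _ s ↦ (Bouquet.loop s).source)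
    (fun _ s ↦ (Bouquet.loop s).target)

lemma continuous_toBouquet : Continuous (toBouquet (φ := φ)) :=
  continuous_of_cells fun _ s ↦ (Bouquet.loop s).continuous

lemma toBouquet_letterPath (g : G) (a : S × Bool) (t : unitInterval) :
    toBouquet (letterPath φ g a t) = Bouquet.letterLoop a t := by
  obtain ⟨s, _ | _⟩ := a <;> rfl

lemma toBouquet_wordPath (g : G) (w : List (S × Bool)) (t : unitInterval) :
    toBouquet (wordPath φ g w t) = Bouquet.wordLoop w t := by
  induction w generalizing g t with
  | nil => rfl
  | cons a w ih =>
    cases w with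
    | nil => exact toBouquet_letterPath g a t
    | cons b w =>
      rw [wordPath, Bouquet.wordLoop, Path.cast_coe, Path.trans_apply, Path.trans_apply]
      split_ifs
      · exact toBouquet_letterPath _ _ _
      · exact ih _ _

instance : MulAction G (CayleyGraph φ) where
  smul k := lift (fun g ↦ vertex φ (k * g)) (fun g s t ↦ edge φ (k * g) s t)
    (fun g s ↦ (edge φ (k * g) s).source)
    (fun g s ↦ by rw [← mul_assoc]; exact (edge φ (k * g) s).target)
  one_smul x := by
    induction x using ind with
    | h0 g => exact congrArg (vertex φ) (one_mul g)
    | h1 g s t => exact congrArg (fun g ↦ edge φ g s t) (one_mul g)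
  mul_smul k l x := by
    induction x using ind with
    | h0 g => exact congrArg (vertex φ) (mul_assoc k l g)
    | h1 g s t => exact congrArg (fun g ↦ edge φ g s t) (mul_assoc k l g)

lemma smul_vertex (k g : G) : k • vertex φ g = vertex φ (k * g) := rfl

lemma smul_edge (k g : G) (s : S) (t : unitInterval) : k • edge φ g s t = edge φ (k * g) s t := rfl

lemma smul_letterPath (k g : G) (a : S × Bool) (t : unitInterval) :
    k • letterPath φ g a t = letterPath φ (k * g) a t := by
  obtain ⟨s, _ | _⟩ := a
  · exact congrArg (fun g ↦ edge φ g s (unitInterval.symm t)) (mul_assoc _ _ _).symm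
  · rfl

lemma smul_wordPath (k g : G) (w : List (S × Bool)) (t : unitInterval) :
    k • wordPath φ g w t = wordPath φ (k * g) w t := by
  induction w generalizing g t with
  | nil => rfl
  | cons a w ih =>
    cases w with
    | nil => exact smul_letterPath k g a t
    | cons b w =>
      rw [wordPath, wordPath, Path.cast_coe, Path.cast_coe, Path.trans_apply, Path.trans_apply]
      split_ifs
      · exact smul_letterPath _ _ _ _
      · rw [ih]
        exact congrArg (fun g ↦ wordPath φ g (b :: w) _) (mul_assoc _ _ _).symm

instance : ContinuousConstSMul G (CayleyGraph φ) where
  continuous_const_smul k := continuous_of_cells fun g s ↦ (edge φ (k * g) s).continuous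

/-- The function with values `a` on the vertices and bumps of height `b / 4` on the edges. -/
def weight (φ : FreeGroup S →* G) (a : G → ℝ) (b : G → S → ℝ) : CayleyGraph φ → ℝ :=
  lift a (fun g s t ↦ (1 - t) * a g + t * a (g * φ (FreeGroup.of s)) + t * (1 - t) * b g s)
    (fun g s ↦ by simp) (fun g s ↦ by simp)

variable (a : G → ℝ) (b : G → S → ℝ)

lemma weight_vertex (g : G) : weight φ a b (vertex φ g) = a g := rfl

lemma weight_edge (g : G) (s : S) (t : unitInterval) : weight φ a b (edge φ g s t) =
    (1 - t) * a g + t * a (g * φ (FreeGroup.of s)) + t * (1 - t) * b g s := rfl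

lemma continuous_weight : Continuous (weight φ a b) := by
  refine continuous_of_cells fun g s ↦ ?_
  simp only [weight_edge]
  fun_prop

end CayleyGraph

variable [DecidableEq S]

/-- Attaching of discs to the Cayley graph, one for each group element and each relator. -/
inductive CayleyAttachRel (φ : FreeGroup S →* G) (rel : ι → FreeGroup S) :
    CayleyGraph φ ⊕ (Σ _ : G × ι, Metric.closedBall (0 : ℂ) 1) →
      CayleyGraph φ ⊕ (Σ _ : G × ι, Metric.closedBall (0 : ℂ) 1) → Prop
  | glue (g : G) (i : ι) (t : unitInterval) :
      CayleyAttachRel φ rel (Sum.inl (CayleyGraph.wordPath φ g (rel i).toWord t))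
        (Sum.inr ⟨(g, i), discBoundary t⟩)

/-- The Cayley complex of a group with respect to the images of the generators `S` and a family of
relators. -/
def CayleyComplex (φ : FreeGroup S →* G) (rel : ι → FreeGroup S) : Type :=
  Quot (CayleyAttachRel φ rel)

namespace CayleyComplex

open CayleyGraph

variable (φ : FreeGroup S →* G) (rel : ι → FreeGroup S)

instance : TopologicalSpace (CayleyComplex φ rel) := inferInstanceAs (TopologicalSpace (Quot _))

/-- The inclusion of the Cayley graph. -/
def ofGraph (x : CayleyGraph φ) : CayleyComplex φ rel := Quot.mk _ (Sum.inl x)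

/-- The characteristic map of a face. -/
def face (g : G) (i : ι) (z : Metric.closedBall (0 : ℂ) 1) : CayleyComplex φ rel :=
  Quot.mk _ (Sum.inr ⟨(g, i), z⟩)

lemma continuous_ofGraph : Continuous (ofGraph φ rel) := continuous_quot_mk.comp continuous_inl

lemma continuous_face (g : G) (i : ι) : Continuous (face φ rel g i) :=
  continuous_quot_mk.comp (continuous_inr.comp continuous_sigmaMk)

lemma face_discBoundary (g : G) (i : ι) (t : unitInterval) :
    face φ rel g i (discBoundary t) = ofGraph φ rel (wordPath φ g (rel i).toWord t) :=
  (Quot.sound (CayleyAttachRel.glue g i t)).symm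

variable {φ rel}

/-- Every point lies on the graph or in an open face. -/
@[elab_as_elim]
lemma ind {P : CayleyComplex φ rel → Prop} (h1 : ∀ x, P (ofGraph φ rel x))
    (h2 : ∀ g i (z : Metric.closedBall (0 : ℂ) 1), ‖(z : ℂ)‖ < 1 → P (face φ rel g i z)) (x : CayleyComplex φ rel) : P x := by
  obtain ⟨x | ⟨⟨g, i⟩, z⟩⟩ := x
  · exact h1 x
  · rcases (mem_closedBall_zero_iff.1 z.2).lt_or_eq with hz | hz
    · exact h2 g i z hz
    · have := h1 (wordPath φ g (rel i).toWord (discAngle z))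
      rw [← face_discBoundary, discBoundary_discAngle hz] at this
      exact this

/-- Functions on the Cayley complex from functions on the graph and on the faces. -/
def lift {Z : Type*} (f1 : CayleyGraph φ → Z) (f2 : G → ι → Metric.closedBall (0 : ℂ) 1 → Z)
    (h : ∀ g i t, f2 g i (discBoundary t) = f1 (wordPath φ g (rel i).toWord t)) :
    CayleyComplex φ rel → Z :=
  Quot.lift (Sum.elim f1 (fun x ↦ f2 x.1.1 x.1.2 x.2)) (by
    rintro _ _ ⟨g, i, t⟩
    exact (h g i t).symm)

lemma continuous_of_cells {Z : Type*} [TopologicalSpace Z] {f : CayleyComplex φ rel → Z}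
    (h1 : Continuous fun x ↦ f (ofGraph φ rel x))
    (h2 : ∀ g i, Continuous fun z ↦ f (face φ rel g i z)) : Continuous f :=
  isQuotientMap_quot_mk.continuous_iff.2 (continuous_sum_dom.2
    ⟨h1, continuous_sigma fun x ↦ h2 x.1 x.2⟩)

lemma isClosed_of_cells {A : Set (CayleyComplex φ rel)}
    (h1 : ∀ g s, IsClosed {t | ofGraph φ rel (edge φ g s t) ∈ A})
    (h2 : ∀ g i, IsClosed {z | face φ rel g i z ∈ A}) : IsClosed A := by
  have hq : IsQuotientMap (Quot.mk (CayleyAttachRel φ rel)) := isQuotientMap_quot_mk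
  refine hq.isClosed_preimage.1 (isClosed_sum_iff.2 ⟨?_, ?_⟩)
  · exact CayleyGraph.isClosed_of_cells h1
  · exact isClosed_sigma_iff.2 fun x ↦ h2 x.1 x.2

instance : MulAction G (CayleyComplex φ rel) where
  smul k := lift (fun x ↦ ofGraph φ rel (k • x)) (fun g i z ↦ face φ rel (k * g) i z)
    (fun g i t ↦ by rw [smul_wordPath]; exact face_discBoundary φ rel _ i t)
  one_smul x := by
    induction x using ind with
    | h1 x => exact congrArg (ofGraph φ rel) (one_smul G x)
    | h2 g i z => exact congrArg (fun g ↦ face φ rel g i z) (one_mul g)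
  mul_smul k l x := by
    induction x using ind with
    | h1 x => exact congrArg (ofGraph φ rel) (mul_smul k l x)
    | h2 g i z => exact congrArg (fun g ↦ face φ rel g i z) (mul_assoc k l g)

lemma smul_ofGraph (k : G) (x : CayleyGraph φ) :
    k • ofGraph φ rel x = ofGraph φ rel (k • x) := rfl

lemma smul_face (k g : G) (i : ι) (z : Metric.closedBall (0 : ℂ) 1) :
    k • face φ rel g i z = face φ rel (k * g) i z := rfl

instance : ContinuousConstSMul G (CayleyComplex φ rel) where
  continuous_const_smul k := continuous_of_cells
    ((continuous_ofGraph φ rel).comp (continuous_const_smul k))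
    (fun g i ↦ continuous_face φ rel (k * g) i)

/-- The projection of the Cayley complex to the presentation complex. -/
def toPresentationComplex : CayleyComplex φ rel → PresentationComplex rel :=
  lift (fun x ↦ Quot.mk _ (Sum.inl (toBouquet x))) (fun _ i z ↦ Quot.mk _ (Sum.inr ⟨i, z⟩))
    (fun g i t ↦ by
      rw [toBouquet_wordPath]
      exact (Quot.sound (AttachRel.glue i t)).symm)

lemma isQuotientMap_toPresentationComplex :
    IsQuotientMap (toPresentationComplex (φ := φ) (rel := rel)) := by
  have hc : Continuous (toPresentationComplex (φ := φ) (rel := rel)) := continuous_of_cells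
    (continuous_quot_mk.comp (continuous_inl.comp continuous_toBouquet))
    (fun g i ↦ continuous_quot_mk.comp (continuous_inr.comp
      (continuous_sigmaMk (ι := ι) (σ := fun _ ↦ Metric.closedBall (0 : ℂ) 1))))
  refine ⟨isCoinducing_iff.2 fun U ↦ ⟨fun hU ↦ ?_, fun hU ↦ hU.preimage hc⟩, ?_⟩
  rotate_left
  · intro y
    obtain ⟨x | ⟨i, z⟩, rfl⟩ := Quot.exists_rep y
    · obtain ⟨_ | ⟨s, t⟩, rfl⟩ := Quot.exists_rep x
      · exact ⟨ofGraph φ rel (vertex φ 1), rfl⟩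
      · exact ⟨ofGraph φ rel (edge φ 1 s t), rfl⟩
    · exact ⟨face φ rel 1 i z, rfl⟩
  · have hq : IsQuotientMap (Quot.mk (AttachRel rel)) := isQuotientMap_quot_mk
    have hq' : IsQuotientMap (Quot.mk (BouquetRel S)) := isQuotientMap_quot_mk
    -- Openness in the presentation complex is tested on each cell, and each cell lifts to the cell
    -- of the Cayley complex based at 1.
    refine hq.isOpen_preimage.1 (isOpen_sum_iff.2 ⟨?_, ?_⟩)
    · refine hq'.isOpen_preimage.1 (isOpen_sum_iff.2 ⟨isOpen_discrete _, ?_⟩)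
      refine isOpen_sigma_iff.2 fun s ↦ ?_
      exact (hU.preimage (continuous_ofGraph φ rel)).preimage (edge φ 1 s).continuous
    · refine isOpen_sigma_iff.2 fun i ↦ ?_
      exact hU.preimage (continuous_face φ rel 1 i)

lemma toPresentationComplex_smul (k : G) (x : CayleyComplex φ rel) :
    toPresentationComplex (k • x) = toPresentationComplex x := by
  induction x using ind with
  | h1 x =>
    induction x using CayleyGraph.ind with
    | h0 g => rfl
    | h1 g s t => rfl
  | h2 g i z => rfl

/-- Instead of analysing the equivalence relation generated by the gluings, a map `q` from the
presentation complex to the orbit space is built from the cells based at 1. The orbit map factors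
through it, so points with the same image lie in one orbit. -/
lemma toPresentationComplex_eq_iff {x y : CayleyComplex φ rel} :
    toPresentationComplex x = toPresentationComplex y ↔ x ∈ MulAction.orbit G y := by
  constructor
  · intro h
    let Q := MulAction.orbitRel.Quotient G (CayleyComplex φ rel)
    let mk : CayleyComplex φ rel → Q := Quotient.mk _
    have hmk (k : G) (x) : mk (k • x) = mk x := Quotient.sound ⟨k, rfl⟩
    have hv (g : G) : mk (ofGraph φ rel (vertex φ g)) = mk (ofGraph φ rel (vertex φ 1)) := by
      rw [← hmk g (ofGraph φ rel (vertex φ 1)), smul_ofGraph, smul_vertex, mul_one]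
    have he (g : G) (s t) :
        mk (ofGraph φ rel (edge φ g s t)) = mk (ofGraph φ rel (edge φ 1 s t)) := by
      rw [← hmk g (ofGraph φ rel (edge φ 1 s t)), smul_ofGraph, smul_edge, mul_one]
    have hf (g : G) (i z) : mk (face φ rel g i z) = mk (face φ rel 1 i z) := by
      rw [← hmk g (face φ rel 1 i z), smul_face, mul_one]
    let b : Bouquet S → Q := Quot.lift (Sum.elim (fun _ ↦ mk (ofGraph φ rel (vertex φ 1)))
      (fun x ↦ mk (ofGraph φ rel (edge φ 1 x.1 x.2)))) (by
        rintro _ _ (s | s)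
        · exact congrArg (fun x ↦ mk (ofGraph φ rel x)) (edge φ 1 s).source.symm
        · refine Eq.trans ?_
            (congrArg (fun x ↦ mk (ofGraph φ rel x)) (edge φ 1 s).target.symm)
          exact (hv _).symm)
    have hb (x : CayleyGraph φ) : b (toBouquet x) = mk (ofGraph φ rel x) := by
      induction x using CayleyGraph.ind with
      | h0 g => exact (hv g).symm
      | h1 g s t => exact (he g s t).symm
    let q : PresentationComplex rel → Q := Quot.lift
      (Sum.elim b (fun x ↦ mk (face φ rel 1 x.1 x.2))) (by
        rintro _ _ ⟨i, t⟩
        change b (Bouquet.wordLoop _ t) = mk (face φ rel 1 i (discBoundary t))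
        rw [← toBouquet_wordPath (φ := φ) 1, hb, face_discBoundary])
    have hq (x : CayleyComplex φ rel) : q (toPresentationComplex x) = mk x := by
      induction x using ind with
      | h1 x => exact hb x
      | h2 g i z => exact (hf g i z).symm
    have : mk x = mk y := by rw [← hq, ← hq, h]
    exact MulAction.orbitRel_apply.1 (Quotient.exact this)
  · rintro ⟨k, rfl⟩
    exact toPresentationComplex_smul k y

/-- Relators are trivial in the group, so their lifts to the Cayley graph close up. -/
lemma wordPath_loop (hrel : ∀ i, φ (rel i) = 1) (g : G) (i : ι) :
    wordPath φ g (rel i).toWord 0 = wordPath φ g (rel i).toWord 1 := by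
  rw [Path.source, Path.target, FreeGroup.mk_toWord, hrel, mul_one]

/-- The function that is `CayleyGraph.weight` on the graph, and on each face the conical extension
with value `c` at the centre. -/
noncomputable def weight (hrel : ∀ i, φ (rel i) = 1) (a : G → ℝ) (b : G → S → ℝ) (c : G → ι → ℝ) :
    CayleyComplex φ rel → ℝ :=
  lift (CayleyGraph.weight φ a b)
    (fun g i z ↦ ‖(z : ℂ)‖ * CayleyGraph.weight φ a b (wordPath φ g (rel i).toWord (discAngle z)) +
      (1 - ‖(z : ℂ)‖) * c g i)
    (fun g i t ↦ by
      rw [norm_discBoundary, one_mul, sub_self, zero_mul, add_zero]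
      exact apply_discAngle_discBoundary
        (fun t ↦ CayleyGraph.weight φ a b (wordPath φ g (rel i).toWord t))
        (by rw [wordPath_loop hrel]) t)

variable (hrel : ∀ i, φ (rel i) = 1) (a : G → ℝ) (b : G → S → ℝ) (c : G → ι → ℝ)

lemma weight_ofGraph (x : CayleyGraph φ) :
    weight hrel a b c (ofGraph φ rel x) = CayleyGraph.weight φ a b x := rfl

lemma weight_face (g : G) (i : ι) (z) : weight hrel a b c (face φ rel g i z) =
    ‖(z : ℂ)‖ * CayleyGraph.weight φ a b (wordPath φ g (rel i).toWord (discAngle z)) +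
      (1 - ‖(z : ℂ)‖) * c g i := rfl

lemma continuous_weight : Continuous (weight hrel a b c) := by
  refine continuous_of_cells (CayleyGraph.continuous_weight a b) fun g i ↦ ?_
  simp only [weight_face]
  refine (continuous_norm_mul_discAngle (f := fun t ↦ CayleyGraph.weight φ a b
    (wordPath φ g (rel i).toWord t)) ?_ ?_).add ?_
  · exact (CayleyGraph.continuous_weight a b).comp (Path.continuous _)
  · rw [wordPath_loop hrel]
  · fun_prop

end CayleyComplex

end Cayley

/-! ### Separation by weights and the covering map -/

open Topology

section Cayley

variable {G S ι : Type}

open scoped Classical in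
/-- The indicator function of a group element. -/
noncomputable def vertexBump (g : G) : G → ℝ := fun g' ↦ if g' = g then 1 else 0

open scoped Classical in
/-- The indicator function of a labelled group element. -/
noncomputable def cellBump {α : Type} (g : G) (s : α) : G → α → ℝ :=
  fun g' s' ↦ if g' = g ∧ s' = s then 1 else 0

lemma vertexBump_self (g : G) : vertexBump g g = 1 := if_pos rfl

lemma cellBump_self {α : Type} (g : G) (s : α) : cellBump g s g s = 1 := if_pos ⟨rfl, rfl⟩

lemma eq_of_cellBump_pos {α : Type} {g g' : G} {s s' : α} (h : 0 < cellBump g s g' s') :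
    g' = g ∧ s' = s := by
  by_contra hn
  simp [cellBump, hn] at h

variable [Group G]

namespace CayleyGraph

variable {φ : FreeGroup S →* G}

/-- Every point of the Cayley graph is a vertex or lies in an open edge. -/
@[elab_as_elim]
lemma ind_open {P : CayleyGraph φ → Prop} (h0 : ∀ g, P (vertex φ g))
    (h1 : ∀ g s (t : unitInterval), 0 < (t : ℝ) → (t : ℝ) < 1 → P (edge φ g s t))
    (x : CayleyGraph φ) : P x := by
  induction x using ind with
  | h0 g => exact h0 g
  | h1 g s t =>
    rcases t.2.1.eq_or_lt with ht | ht
    · obtain rfl : t = 0 := Subtype.ext ht.symm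
      rw [Path.source]
      exact h0 _
    rcases t.2.2.eq_or_lt with ht' | ht'
    · obtain rfl : t = 1 := Subtype.ext ht'
      rw [Path.target]
      exact h0 _
    exact h1 g s t ht ht'

end CayleyGraph

lemma vertexBump_mul (k g g' : G) : vertexBump g (k * g') = vertexBump (k⁻¹ * g) g' := by
  classical exact if_congr (by rw [eq_inv_mul_iff_mul_eq]) rfl rfl

lemma cellBump_mul {α : Type} (k g g' : G) (s s' : α) :
    cellBump g s (k * g') s' = cellBump (k⁻¹ * g) s g' s' := by
  classical exact if_congr (by rw [eq_inv_mul_iff_mul_eq]) rfl rfl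

namespace CayleyGraph

variable {φ : FreeGroup S →* G}

lemma weight_smul (k : G) (a : G → ℝ) (b : G → S → ℝ) (x : CayleyGraph φ) :
    weight φ a b (k • x) = weight φ (fun g ↦ a (k * g)) (fun g ↦ b (k * g)) x := by
  induction x using ind with
  | h0 g => rfl
  | h1 g s t => rw [smul_edge, weight_edge, weight_edge, mul_assoc]

/-- The hat functions of two different vertices have sum at most 1 at every vertex, hence by linear
interpolation at every point. -/
lemma eq_of_half_lt_weight {g g' : G} {x : CayleyGraph φ}
    (h : 1 / 2 < weight φ (vertexBump g) 0 x) (h' : 1 / 2 < weight φ (vertexBump g') 0 x) :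
    g = g' := by
  by_contra hn
  have key (k : G) : vertexBump g k + vertexBump g' k ≤ 1 := by
    unfold vertexBump
    split_ifs with h1 h2 <;> norm_num
    exact hn (h1.symm.trans h2)
  induction x using ind with
  | h0 k =>
    rw [weight_vertex] at h h'
    linarith [key k]
  | h1 k s t =>
    rw [weight_edge] at h h'
    have h0 := mul_le_mul_of_nonneg_left (key k) (sub_nonneg.2 t.2.2)
    have h1 := mul_le_mul_of_nonneg_left (key (k * φ (FreeGroup.of s))) t.2.1
    simp only [Pi.zero_apply, mul_zero, add_zero] at h h'
    nlinarith

lemma eq_of_weight_cellBump_pos {g g' : G} {s s' : S} {x : CayleyGraph φ}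
    (h : 0 < weight φ 0 (cellBump g s) x) (h' : 0 < weight φ 0 (cellBump g' s') x) :
    g = g' ∧ s = s' := by
  induction x using ind with
  | h0 k => exact absurd h (lt_irrefl _)
  | h1 k r t =>
    rw [weight_edge] at h h'
    simp only [Pi.zero_apply, mul_zero, zero_add] at h h'
    have ht : 0 ≤ (t : ℝ) * (1 - t) := mul_nonneg t.2.1 (sub_nonneg.2 t.2.2)
    obtain ⟨rfl, rfl⟩ := eq_of_cellBump_pos (pos_of_mul_pos_right h ht)
    obtain ⟨rfl, rfl⟩ := eq_of_cellBump_pos (pos_of_mul_pos_right h' ht)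
    exact ⟨rfl, rfl⟩

/-- Weights separate the points of the graph. -/
lemma eq_of_weight_eq (hφ : ∀ s, φ (FreeGroup.of s) ≠ 1) {x y : CayleyGraph φ}
    (h : ∀ a b, weight φ a b x = weight φ a b y) : x = y := by
  have hb (g : G) (s : S) : vertexBump g (g * φ (FreeGroup.of s)) = 0 :=
    if_neg fun h ↦ hφ s (mul_eq_left.1 h)
  have hE (g : G) (s : S) (t : unitInterval) (h0 : 0 < (t : ℝ)) (h1 : (t : ℝ) < 1)
      (y : CayleyGraph φ)
      (h : ∀ a b, weight φ a b (edge φ g s t) = weight φ a b y) : edge φ g s t = y := by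
    have hp : 0 < weight φ 0 (cellBump g s) (edge φ g s t) := by
      rw [weight_edge, cellBump_self]
      simpa using mul_pos h0 (sub_pos.2 h1)
    have hp' := hp
    rw [h] at hp'
    induction y using ind with
    | h0 k => exact absurd hp' (lt_irrefl _)
    | h1 k r t' =>
      have hp2 : 0 < weight φ 0 (cellBump k r) (edge φ k r t') := by
        rw [weight_edge] at hp'
        rw [weight_edge, cellBump_self]
        simp only [Pi.zero_apply, mul_zero, zero_add, mul_one] at hp' ⊢
        refine lt_of_le_of_ne (mul_nonneg t'.2.1 (sub_nonneg.2 t'.2.2)) fun h' ↦ ?_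
        rw [← h', zero_mul] at hp'
        exact lt_irrefl _ hp'
      obtain ⟨rfl, rfl⟩ := eq_of_weight_cellBump_pos hp' hp2
      -- By `hφ` no edge is a loop, so the hat function of the starting vertex is 1 - t on the edge
      -- and recovers t.
      have := h (vertexBump g) 0
      simp only [weight_edge, hb, vertexBump_self, Pi.zero_apply] at this
      congr 1
      apply Subtype.ext
      linarith
  induction x using ind_open with
  | h1 g s t h0 h1 => exact hE g s t h0 h1 y h
  | h0 g =>
    induction y using ind_open with
    | h1 g' s t h0 h1 => exact (hE g' s t h0 h1 _ fun a b ↦ (h a b).symm).symm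
    | h0 g' =>
      have := h (vertexBump g) 0
      rw [weight_vertex, weight_vertex, vertexBump_self, vertexBump] at this
      split_ifs at this with hg
      · rw [hg]
      · exact absurd this one_ne_zero

end CayleyGraph

namespace CayleyComplex

open CayleyGraph

variable [DecidableEq S] {φ : FreeGroup S →* G} {rel : ι → FreeGroup S}
  (hrel : ∀ i, φ (rel i) = 1)

lemma weight_smul (k : G) (a : G → ℝ) (b : G → S → ℝ) (c : G → ι → ℝ) (x : CayleyComplex φ rel) :
    weight hrel a b c (k • x) =
      weight hrel (fun g ↦ a (k * g)) (fun g ↦ b (k * g)) (fun g ↦ c (k * g)) x := by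
  induction x using ind with
  | h1 x => exact CayleyGraph.weight_smul k a b x
  | h2 g i z =>
    rw [smul_face, weight_face, weight_face, ← smul_wordPath, CayleyGraph.weight_smul]

/-- The weights with value zero at the centres of the faces are bounded by their values at a
point of the graph. -/
lemma exists_lt_weight_graph (x : CayleyComplex φ rel) : ∃ y : CayleyGraph φ, ∀ a b r, 0 ≤ r →
    r < weight hrel a b 0 x → r < CayleyGraph.weight φ a b y := by
  induction x using ind with
  | h1 x => exact ⟨x, fun a b r _ h ↦ h⟩
  | h2 g i z hz =>
    refine ⟨wordPath φ g (rel i).toWord (discAngle z), fun a b r hr h ↦ ?_⟩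
    rw [weight_face] at h
    simp only [Pi.zero_apply, mul_zero, add_zero] at h
    have hpos := pos_of_mul_pos_right (hr.trans_lt h) (norm_nonneg _)
    refine h.trans_le (mul_le_of_le_one_left hpos.le hz.le)

lemma weight_zero_face (c : G → ι → ℝ) (g : G) (i : ι) (z : Metric.closedBall (0 : ℂ) 1) :
    weight hrel 0 0 c (face φ rel g i z) = (1 - ‖(z : ℂ)‖) * c g i := by
  have h0 (y : CayleyGraph φ) : CayleyGraph.weight φ 0 0 y = 0 := by
    induction y using CayleyGraph.ind with
    | h0 g => rfl
    | h1 g s t => simp [weight_edge]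
  rw [weight_face, h0, mul_zero, zero_add]

lemma weight_zero_ofGraph (c : G → ι → ℝ) (x : CayleyGraph φ) :
    weight hrel 0 0 c (ofGraph φ rel x) = 0 := by
  rw [weight_ofGraph]
  induction x using CayleyGraph.ind with
  | h0 g => rfl
  | h1 g s t => simp [weight_edge]

include hrel in
-- The neighbourhood of a point is a superlevel set of the weight of the open cell that contains it:
-- above 1/2 for a vertex, above 0 for an edge or a face. Translation by k turns this weight into
-- the weight of a translated cell, and the superlevel sets of different cells of the same kind are
-- disjoint. Only k = 1 is left.
theorem isQuotientCoveringMap_toPresentationComplex :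
    IsQuotientCoveringMap (toPresentationComplex (φ := φ) (rel := rel)) G where
  toIsQuotientMap := isQuotientMap_toPresentationComplex
  toContinuousConstSMul := inferInstance
  apply_eq_iff_mem_orbit := toPresentationComplex_eq_iff
  disjoint x := by
    have hU {a : G → ℝ} {b : G → S → ℝ} {c : G → ι → ℝ} {r : ℝ} {x : CayleyComplex φ rel}
        (h : r < weight hrel a b c x) : {x | r < weight hrel a b c x} ∈ 𝓝 x :=
      (isOpen_lt continuous_const (continuous_weight hrel a b c)).mem_nhds h
    induction x using ind with
    | h1 x =>
      induction x using ind_open with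
      | h0 g =>
        refine ⟨{x | 1 / 2 < weight hrel (vertexBump g) 0 0 x}, hU ?_, ?_⟩
        · rw [weight_ofGraph, weight_vertex, vertexBump_self]
          norm_num
        · rintro k ⟨_, ⟨x, h1, rfl⟩, h2⟩
          simp only [Set.mem_ofPred_eq, weight_smul, vertexBump_mul] at h1 h2
          obtain ⟨y, hy⟩ := exists_lt_weight_graph hrel x
          have := eq_of_half_lt_weight (hy _ _ _ (by norm_num) h1) (hy _ _ _ (by norm_num) h2)
          simpa using this
      | h1 g s t h0 h1 =>
        refine ⟨{x | 0 < weight hrel 0 (cellBump g s) 0 x}, hU ?_, ?_⟩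
        · rw [weight_ofGraph, weight_edge, cellBump_self]
          simpa using mul_pos h0 (sub_pos.2 h1)
        · rintro k ⟨_, ⟨x, h1, rfl⟩, h2⟩
          simp only [Set.mem_ofPred_eq, weight_smul] at h1 h2
          have hk : (fun g' ↦ cellBump g s (k * g')) = cellBump (k⁻¹ * g) s := by
            funext g' s'
            exact cellBump_mul k g g' s s'
          rw [hk] at h2
          obtain ⟨y, hy⟩ := exists_lt_weight_graph hrel x
          have := (eq_of_weight_cellBump_pos (hy _ _ _ le_rfl h1) (hy _ _ _ le_rfl h2)).1
          simpa using this
    | h2 g i z hz =>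
      refine ⟨{x | 0 < weight hrel 0 0 (cellBump g i) x}, hU ?_, ?_⟩
      · rw [weight_zero_face, cellBump_self]
        simpa using hz
      · rintro k ⟨_, ⟨x, h1, rfl⟩, h2⟩
        induction x using ind with
        | h1 x =>
          rw [Set.mem_ofPred_eq, weight_zero_ofGraph] at h1
          exact absurd h1 (lt_irrefl _)
        | h2 g' i' z' hz' =>
          simp only [Set.mem_ofPred_eq, smul_face, weight_zero_face] at h1 h2
          have hz0 : 0 ≤ 1 - ‖(z' : ℂ)‖ := by linarith
          have e1 := (eq_of_cellBump_pos (pos_of_mul_pos_right h1 hz0)).1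
          have e2 := (eq_of_cellBump_pos (pos_of_mul_pos_right h2 hz0)).1
          rw [← e1] at e2
          simpa using e2

open scoped Classical in
/-- The map that is zero outside of one face and injective on the circles of a given radius of that
face. -/
noncomputable def faceCoord (g : G) (i : ι) : CayleyComplex φ rel → ℂ :=
  lift (fun _ ↦ 0) (fun g' i' z ↦ if g' = g ∧ i' = i then (1 - ‖(z : ℂ)‖ : ℝ) * z else 0)
    (fun g' i' t ↦ by simp [norm_discBoundary])

lemma faceCoord_face (g : G) (i : ι) (z : Metric.closedBall (0 : ℂ) 1) :
    faceCoord g i (face φ rel g i z) = (1 - ‖(z : ℂ)‖ : ℝ) * z := if_pos ⟨rfl, rfl⟩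

lemma continuous_faceCoord (g : G) (i : ι) :
    Continuous (faceCoord (φ := φ) (rel := rel) g i) := by
  refine continuous_of_cells continuous_const fun g' i' ↦ ?_
  by_cases h : g' = g ∧ i' = i
  · obtain ⟨rfl, rfl⟩ := h
    simp only [faceCoord_face]
    fun_prop
  · have : (fun z ↦ faceCoord g i (face φ rel g' i' z)) = fun _ ↦ 0 := by
      funext z
      exact if_neg h
    rw [this]
    exact continuous_const

/-- Weights and face coordinates separate points. -/
lemma eq_of_weight_eq (hφ : ∀ s, φ (FreeGroup.of s) ≠ 1) {x y : CayleyComplex φ rel}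
    (h : ∀ a b c, weight hrel a b c x = weight hrel a b c y)
    (h' : ∀ g i, faceCoord g i x = faceCoord g i y) : x = y := by
  have hF (g : G) (i : ι) (z : Metric.closedBall (0 : ℂ) 1) (hz : ‖(z : ℂ)‖ < 1)
      (y : CayleyComplex φ rel)
      (h : ∀ a b c, weight hrel a b c (face φ rel g i z) = weight hrel a b c y)
      (h' : ∀ g' i', faceCoord g' i' (face φ rel g i z) = faceCoord g' i' y) :
      face φ rel g i z = y := by
    have h1 := h 0 0 (cellBump g i)
    rw [weight_zero_face, cellBump_self, mul_one] at h1
    induction y using ind with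
    | h1 y =>
      rw [weight_zero_ofGraph] at h1
      linarith
    | h2 g' i' z' hz' =>
      rw [weight_zero_face] at h1
      have h2 : 0 < cellBump g i g' i' :=
        pos_of_mul_pos_right (h1 ▸ sub_pos.2 hz) (sub_nonneg.2 hz'.le)
      obtain ⟨rfl, rfl⟩ := eq_of_cellBump_pos h2
      rw [cellBump_self, mul_one] at h1
      have h3 := h' g' i'
      rw [faceCoord_face, faceCoord_face, ← h1] at h3
      have : (((1 - ‖(z : ℂ)‖ : ℝ)) : ℂ) ≠ 0 := by
        exact_mod_cast (sub_pos.2 hz).ne'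
      rw [Subtype.ext (mul_left_cancel₀ this h3)]
  induction x using ind with
  | h2 g i z hz => exact hF g i z hz y h h'
  | h1 x =>
    induction y using ind with
    | h2 g i z hz =>
      exact (hF g i z hz _ (fun a b c ↦ (h a b c).symm) fun g i ↦ (h' g i).symm).symm
    | h1 y => exact congrArg _ (CayleyGraph.eq_of_weight_eq hφ fun a b ↦ h a b 0)

include hrel in
-- Weights and face coordinates together are a continuous injection into a product of real and
-- complex lines.
lemma t2Space (hφ : ∀ s, φ (FreeGroup.of s) ≠ 1) : T2Space (CayleyComplex φ rel) := by
  let f : CayleyComplex φ rel → ((G → ℝ) × (G → S → ℝ) × (G → ι → ℝ) → ℝ) × (G × ι → ℂ) :=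
    fun x ↦ (fun w ↦ weight hrel w.1 w.2.1 w.2.2 x, fun k ↦ faceCoord k.1 k.2 x)
  have hf : Continuous f := (continuous_pi fun w ↦ continuous_weight hrel _ _ _).prodMk
    (continuous_pi fun k ↦ continuous_faceCoord _ _)
  refine T2Space.of_injective_continuous (f := f) (fun x y hxy ↦ ?_) hf
  exact eq_of_weight_eq hrel hφ (fun a b c ↦ congrFun (congrArg Prod.fst hxy) (a, b, c))
    fun g i ↦ congrFun (congrArg Prod.snd hxy) (g, i)

end CayleyComplex

end Cayley

open Topology

/-! ### Absolute extensors for compact Hausdorff spaces -/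

/-- A subset of a space is an extensor if continuous maps into it that are defined on closed subsets
of compact Hausdorff spaces extend. -/
def IsExtensor {Y : Type} [TopologicalSpace Y] (A : Set Y) : Prop :=
  ∀ (X : Type) [TopologicalSpace X] [CompactSpace X] [T2Space X] (C : Set X) (f : X → Y),
    IsClosed C → ContinuousOn f C → Set.MapsTo f C A →
      ∃ F : X → Y, Continuous F ∧ (∀ x, F x ∈ A) ∧ Set.EqOn F f C

namespace IsExtensor

variable {Y : Type} [TopologicalSpace Y]

lemma singleton (y : Y) : IsExtensor {y} := fun _ _ _ _ _ _ _ _ hf ↦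
  ⟨fun _ ↦ y, continuous_const, fun _ ↦ rfl, fun _ hx ↦ (hf hx).symm⟩

/-- A continuous injection of a compact space into a Hausdorff space is an embedding, so Tietze's
theorem for `K` transfers to the image. -/
lemma range {K : Type} [TopologicalSpace K] [CompactSpace K] [TietzeExtension.{0, 0} K] [T2Space Y]
    {χ : K → Y} (hc : Continuous χ) (hi : Function.Injective χ) : IsExtensor (Set.range χ) := by
  intro X _ _ _ C f hC hf hm
  have hχ : IsEmbedding χ := (hc.isClosedEmbedding hi).isEmbedding
  let e := hχ.toHomeomorph
  let f' : C(C, K) := ⟨fun x ↦ e.symm ⟨f x, hm x.2⟩, e.symm.continuous.comp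
    ((continuousOn_iff_continuous_domRestrict.1 hf).subtype_mk _)⟩
  obtain ⟨g, hg⟩ := f'.exists_restrict_eq hC
  refine ⟨χ ∘ g, hc.comp g.continuous, fun x ↦ ⟨_, rfl⟩, fun x hx ↦ ?_⟩
  have h1 : g x = e.symm ⟨f x, hm hx⟩ := DFunLike.congr_fun hg ⟨x, hx⟩
  have h2 : e (e.symm ⟨f x, hm hx⟩) = ⟨f x, hm hx⟩ := e.apply_symm_apply _
  rw [Function.comp_apply, h1]
  exact congrArg Subtype.val h2

/-- A union of two extensors with intersection an extensor is an extensor. -/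
lemma union {A B : Set Y} (hA : IsExtensor A) (hB : IsExtensor B) (hAB : IsExtensor (A ∩ B))
    {u : Y → ℝ} (hu : Continuous u) (huA : ∀ y ∈ A ∪ B, y ∈ A ↔ u y ≤ 0)
    (huB : ∀ y ∈ A ∪ B, y ∈ B ↔ 0 ≤ u y) : IsExtensor (A ∪ B) := by
  classical
  intro X _ _ _ C f hC hf hm
  -- By Tietze's theorem u ∘ f extends to a real function v on X, whose sign cuts X into two closed
  -- halves. The map is extended first over {v = 0} into A ∩ B, then over v ≤ 0 into A and over v ≥
  -- 0 into B; the two extensions agree on {v = 0}.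
  obtain ⟨v, hv⟩ := ContinuousMap.exists_restrict_eq hC
    (⟨fun x ↦ u (f x), hu.comp (continuousOn_iff_continuous_domRestrict.1 hf)⟩ : C(C, ℝ))
  have hv' : ∀ x ∈ C, v x = u (f x) := fun x hx ↦ DFunLike.congr_fun hv ⟨x, hx⟩
  have hvc := v.continuous
  have hZ : IsClosed {x | v x = 0} := isClosed_eq hvc continuous_const
  obtain ⟨F0, hF0, hF0m, hF0e⟩ := hAB X (C ∩ {x | v x = 0}) f (hC.inter hZ)
    (hf.mono Set.inter_subset_left) (fun x hx ↦ by
      have h0 : u (f x) = 0 := by rw [← hv' x hx.1]; exact hx.2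
      exact ⟨(huA _ (hm hx.1)).2 h0.le, (huB _ (hm hx.1)).2 h0.ge⟩)
  let f1 : X → Y := fun x ↦ if v x = 0 then F0 x else f x
  have hf1Z : Set.EqOn f1 F0 {x | v x = 0} := fun x hx ↦ if_pos hx
  have hf1C : Set.EqOn f1 f C := fun x hx ↦ by
    by_cases h : v x = 0
    · exact (if_pos h).trans (hF0e ⟨hx, h⟩)
    · exact if_neg h
  have hc1 {D : Set X} (hD : IsClosed D) : ContinuousOn f1 ({x | v x = 0} ∪ (C ∩ D)) :=
    ContinuousOn.union_of_isClosed (hF0.continuousOn.congr hf1Z)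
      ((hf.congr hf1C).mono Set.inter_subset_left) hZ (hC.inter hD)
  have hDA : IsClosed {x | v x ≤ 0} := isClosed_le hvc continuous_const
  have hDB : IsClosed {x | 0 ≤ v x} := isClosed_le continuous_const hvc
  obtain ⟨FA, hFA, hFAm, hFAe⟩ := hA X ({x | v x = 0} ∪ (C ∩ {x | v x ≤ 0})) f1
    (hZ.union (hC.inter hDA)) (hc1 hDA) (by
      rintro x (hx | hx)
      · rw [hf1Z hx]
        exact (hF0m x).1
      · rw [hf1C hx.1]
        exact (huA _ (hm hx.1)).2 ((hv' x hx.1).symm.trans_le hx.2))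
  obtain ⟨FB, hFB, hFBm, hFBe⟩ := hB X ({x | v x = 0} ∪ (C ∩ {x | 0 ≤ v x})) f1
    (hZ.union (hC.inter hDB)) (hc1 hDB) (by
      rintro x (hx | hx)
      · rw [hf1Z hx]
        exact (hF0m x).2
      · rw [hf1C hx.1]
        exact (huB _ (hm hx.1)).2 (hx.2.trans_eq (hv' x hx.1)))
  refine ⟨fun x ↦ if v x ≤ 0 then FA x else FB x, ?_, fun x ↦ ?_, fun x hx ↦ ?_⟩
  · refine Continuous.if_le hFA hFB hvc continuous_const fun x hx ↦ ?_
    rw [hFAe (Or.inl hx), hFBe (Or.inl hx)]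
  · dsimp only
    split_ifs
    exacts [Or.inl (hFAm x), Or.inr (hFBm x)]
  · dsimp only
    split_ifs with h
    · rw [hFAe (Or.inr ⟨hx, h⟩), hf1C hx]
    · rw [hFBe (Or.inr ⟨hx, (not_le.1 h).le⟩), hf1C hx]

/-- Extensors with the property that each compact subset of the union lies in one of them. -/
lemma of_isCompact {A : Set Y}
    (h : ∀ K : Set Y, IsCompact K → K ⊆ A → ∃ B, K ⊆ B ∧ B ⊆ A ∧ IsExtensor B) :
    IsExtensor A := by
  intro X _ _ _ C f hC hf hm
  obtain ⟨B, hKB, hBA, hB⟩ := h (f '' C) (hC.isCompact.image_of_continuousOn hf) hm.image_subset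
  obtain ⟨F, hF, hFm, hFe⟩ := hB X C f hC hf (fun x hx ↦ hKB ⟨x, hx, rfl⟩)
  exact ⟨F, hF, fun x ↦ hBA (hFm x), hFe⟩

end IsExtensor

/-! ### Subcomplexes of Cayley complexes -/

/-- The cells of the Cayley complex. -/
inductive CayleyCell (G S ι : Type)
  | vert (g : G)
  | oneCell (g : G) (s : S)
  | twoCell (g : G) (i : ι)

section Cayley

variable {G S ι : Type} [Group G]

namespace CayleyCell

/-- The cells of a closed edge, which is read in one of the two directions. -/
def letterTrace (ι : Type) (φ : FreeGroup S →* G) (g : G) : S × Bool → Set (CayleyCell G S ι)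
  | (s, true) => {vert g, vert (g * φ (FreeGroup.of s)), oneCell g s}
  | (s, false) =>
    {vert g, vert (g * φ (FreeGroup.mk [(s, false)])), oneCell (g * φ (FreeGroup.mk [(s, false)])) s}

/-- The cells that the edge path of a word meets. -/
def trace (ι : Type) (φ : FreeGroup S →* G) : G → List (S × Bool) → Set (CayleyCell G S ι)
  | g, [] => {vert g}
  | g, a :: w => letterTrace ι φ g a ∪ trace ι φ (g * φ (FreeGroup.mk [a])) w

variable {φ : FreeGroup S →* G}

lemma vert_mem_trace (g : G) (w : List (S × Bool)) : vert g ∈ trace ι φ g w := by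
  cases w with
  | nil => exact rfl
  | cons a w =>
    left
    obtain ⟨s, _ | _⟩ := a <;> exact Or.inl rfl

lemma finite_trace (g : G) (w : List (S × Bool)) : (trace ι φ g w).Finite := by
  induction w generalizing g with
  | nil => exact Set.finite_singleton _
  | cons a w ih =>
    refine Set.Finite.union ?_ (ih _)
    obtain ⟨s, _ | _⟩ := a <;> simp [letterTrace]

variable [DecidableEq S]

/-- Sets of cells that are closed under passage to the boundary. -/
structure IsSubcomplex (φ : FreeGroup S →* G) (rel : ι → FreeGroup S)
    (A : Set (CayleyCell G S ι)) : Prop where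
  left_mem {g s} : oneCell g s ∈ A → vert g ∈ A
  right_mem {g s} : oneCell g s ∈ A → vert (g * φ (FreeGroup.of s)) ∈ A
  trace_subset {g i} : twoCell g i ∈ A → trace ι φ g (rel i).toWord ⊆ A

variable {rel : ι → FreeGroup S} {A B : Set (CayleyCell G S ι)}

lemma IsSubcomplex.union (hA : IsSubcomplex φ rel A) (hB : IsSubcomplex φ rel B) :
    IsSubcomplex φ rel (A ∪ B) where
  left_mem h := h.imp hA.left_mem hB.left_mem
  right_mem h := h.imp hA.right_mem hB.right_mem
  trace_subset h := h.elim (fun h ↦ (hA.trace_subset h).trans Set.subset_union_left)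
    (fun h ↦ (hB.trace_subset h).trans Set.subset_union_right)

lemma IsSubcomplex.inter (hA : IsSubcomplex φ rel A) (hB : IsSubcomplex φ rel B) :
    IsSubcomplex φ rel (A ∩ B) where
  left_mem h := h.imp hA.left_mem hB.left_mem
  right_mem h := h.imp hA.right_mem hB.right_mem
  trace_subset h := Set.subset_inter (hA.trace_subset h.1) (hB.trace_subset h.2)

lemma isSubcomplex_letterTrace (g : G) (a : S × Bool) :
    IsSubcomplex φ rel (letterTrace ι φ g a) := by
  obtain ⟨s, _ | _⟩ := a
  · have h1 : g * φ (FreeGroup.mk [(s, false)]) * φ (FreeGroup.of s) = g := by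
      rw [mul_assoc, ← map_mul]
      change g * φ ((FreeGroup.of s)⁻¹ * FreeGroup.of s) = g
      simp
    constructor <;> simp +contextual [letterTrace, h1]
  · constructor <;> simp +contextual [letterTrace]

lemma isSubcomplex_trace (g : G) (w : List (S × Bool)) :
    IsSubcomplex φ rel (trace ι φ g w) := by
  induction w generalizing g with
  | nil => constructor <;> simp [trace]
  | cons a w ih => exact (isSubcomplex_letterTrace g a).union (ih _)

lemma isSubcomplex_insert_face (g : G) (i : ι) :
    IsSubcomplex φ rel (insert (twoCell g i) (trace ι φ g (rel i).toWord)) := by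
  have h := isSubcomplex_trace (φ := φ) (rel := rel) g (rel i).toWord
  constructor
  · intro g' s h'
    exact Or.inr (h.left_mem (h'.resolve_left (by simp)))
  · intro g' s h'
    exact Or.inr (h.right_mem (h'.resolve_left (by simp)))
  · rintro g' i' (h' | h')
    · obtain ⟨rfl, rfl⟩ := by simpa using h'
      exact Set.subset_insert _ _
    · exact (h.trace_subset h').trans (Set.subset_insert _ _)

end CayleyCell

namespace CayleyComplex

open CayleyGraph CayleyCell

variable [DecidableEq S] {φ : FreeGroup S →* G} {rel : ι → FreeGroup S}
  (hrel : ∀ i, φ (rel i) = 1)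

open scoped Classical in
/-- A function with zero set the realization of a given subcomplex. -/
noncomputable def gauge (A : Set (CayleyCell G S ι)) : CayleyComplex φ rel → ℝ :=
  weight hrel (fun g ↦ if vert g ∈ A then 0 else 1) (fun g s ↦ if oneCell g s ∈ A then 0 else 1)
    (fun g i ↦ if twoCell g i ∈ A then 0 else 1)

lemma continuous_gauge (A : Set (CayleyCell G S ι)) :
    Continuous (gauge (φ := φ) (rel := rel) hrel A) := continuous_weight _ _ _ _

/-- The union of the open cells of a subcomplex. -/
def realize (A : Set (CayleyCell G S ι)) : Set (CayleyComplex φ rel) := {x | gauge hrel A x = 0}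

variable (φ rel) in
/-- The open cells. -/
def openCell : CayleyCell G S ι → Set (CayleyComplex φ rel)
  | vert g => {ofGraph φ rel (vertex φ g)}
  | oneCell g s =>
    {x | ∃ t : unitInterval, 0 < (t : ℝ) ∧ (t : ℝ) < 1 ∧ x = ofGraph φ rel (edge φ g s t)}
  | twoCell g i =>
    {x | ∃ z : Metric.closedBall (0 : ℂ) 1, ‖(z : ℂ)‖ < 1 ∧ x = face φ rel g i z}

lemma exists_mem_openCell (x : CayleyComplex φ rel) : ∃ c, x ∈ openCell φ rel c := by
  induction x using ind with
  | h1 x =>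
    induction x using ind_open with
    | h0 g => exact ⟨vert g, rfl⟩
    | h1 g s t h0 h1 => exact ⟨oneCell g s, t, h0, h1, rfl⟩
  | h2 g i z hz => exact ⟨twoCell g i, z, hz, rfl⟩

section

variable {hrel}

lemma vertex_mem_realize {A : Set (CayleyCell G S ι)} {g : G} :
    ofGraph φ rel (vertex φ g) ∈ realize hrel A ↔ vert g ∈ A := by
  simp [realize, gauge, weight_ofGraph, weight_vertex]

lemma edge_mem_realize {A : Set (CayleyCell G S ι)} (hA : IsSubcomplex φ rel A) {g : G} {s : S}
    (h : oneCell g s ∈ A) (t : unitInterval) :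
    ofGraph φ rel (edge φ g s t) ∈ realize hrel A := by
  simp [realize, gauge, weight_ofGraph, weight_edge, h, hA.left_mem h, hA.right_mem h]

lemma letterPath_mem_realize {A : Set (CayleyCell G S ι)} (hA : IsSubcomplex φ rel A) {g : G}
    {a : S × Bool} (h : letterTrace ι φ g a ⊆ A) (t : unitInterval) :
    ofGraph φ rel (letterPath φ g a t) ∈ realize hrel A := by
  obtain ⟨s, _ | _⟩ := a
  · exact edge_mem_realize hA (h (by simp [letterTrace])) _
  · exact edge_mem_realize hA (h (by simp [letterTrace])) _

lemma wordPath_mem_realize {A : Set (CayleyCell G S ι)} (hA : IsSubcomplex φ rel A) {g : G}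
    {w : List (S × Bool)} (h : trace ι φ g w ⊆ A) (t : unitInterval) :
    ofGraph φ rel (wordPath φ g w t) ∈ realize hrel A := by
  induction w generalizing g t with
  | nil => exact vertex_mem_realize.2 (h rfl)
  | cons a w ih =>
    cases w with
    | nil => exact letterPath_mem_realize hA (Set.subset_union_left.trans h) t
    | cons b w =>
      rw [wordPath, Path.cast_coe, Path.trans_apply]
      split_ifs
      · exact letterPath_mem_realize hA (Set.subset_union_left.trans h) _
      · exact ih (Set.subset_union_right.trans h) _

lemma face_mem_realize {A : Set (CayleyCell G S ι)} (hA : IsSubcomplex φ rel A) {g : G} {i : ι}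
    (h : twoCell g i ∈ A) (z : Metric.closedBall (0 : ℂ) 1) :
    face φ rel g i z ∈ realize hrel A := by
  have := wordPath_mem_realize (hrel := hrel) hA (hA.trace_subset h) (discAngle z)
  rw [realize, Set.mem_ofPred_eq, gauge, weight_ofGraph] at this
  rw [realize, Set.mem_ofPred_eq, gauge, weight_face, this, if_pos h, mul_zero, mul_zero, add_zero]

lemma gauge_nonneg (A : Set (CayleyCell G S ι)) (x : CayleyComplex φ rel) :
    0 ≤ gauge hrel A x := by
  classical
  have hite (p : Prop) [Decidable p] : (0 : ℝ) ≤ if p then 0 else 1 := by split_ifs <;> norm_num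
  have hg (x : CayleyGraph φ) : 0 ≤ gauge hrel A (ofGraph φ rel x) := by
    induction x using CayleyGraph.ind with
    | h0 g => exact hite _
    | h1 g s t =>
      rw [gauge, weight_ofGraph, weight_edge]
      have h0 := t.2.1
      have h1 := sub_nonneg.2 t.2.2
      have := hite (vert g ∈ A)
      have := hite (vert (g * φ (FreeGroup.of s)) ∈ A)
      have := hite (oneCell g s ∈ A)
      positivity
  induction x using ind with
  | h1 x => exact hg x
  | h2 g i z hz =>
    have h1 := hg (wordPath φ g (rel i).toWord (discAngle z))
    rw [gauge, weight_ofGraph] at h1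
    rw [gauge, weight_face]
    exact add_nonneg (mul_nonneg (norm_nonneg _) h1)
      (mul_nonneg (sub_nonneg.2 hz.le) (hite _))

/-- On an open cell the summand of the gauge that belongs to this cell has a positive coefficient,
and the others are nonnegative; so the gauge vanishes only if the cell is in `A`. Conversely, the
subcomplex condition makes the contributions of the boundary vanish as well. Statements about
realizations thereby become statements about sets of cells. -/
lemma mem_realize_iff {A : Set (CayleyCell G S ι)} (hA : IsSubcomplex φ rel A)
    {c : CayleyCell G S ι} {x : CayleyComplex φ rel} (hx : x ∈ openCell φ rel c) :
    x ∈ realize hrel A ↔ c ∈ A := by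
  classical
  cases c with
  | vert g =>
    rw [show x = _ from hx]
    exact vertex_mem_realize
  | oneCell g s =>
    obtain ⟨t, h0, h1, rfl⟩ := hx
    refine ⟨fun h ↦ ?_, fun h ↦ edge_mem_realize hA h t⟩
    by_contra hn
    have hite (p : Prop) [Decidable p] : (0 : ℝ) ≤ if p then 0 else 1 := by
      split_ifs <;> norm_num
    rw [realize, Set.mem_ofPred_eq, gauge, weight_ofGraph, weight_edge, if_neg hn] at h
    have h2 := mul_nonneg (sub_pos.2 h1).le (hite (vert g ∈ A))
    have h3 := mul_nonneg h0.le (hite (vert (g * φ (FreeGroup.of s)) ∈ A))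
    have h4 := mul_pos h0 (sub_pos.2 h1)
    linarith
  | twoCell g i =>
    obtain ⟨z, hz, rfl⟩ := hx
    refine ⟨fun h ↦ ?_, fun h ↦ face_mem_realize hA h z⟩
    by_contra hn
    have h1 := gauge_nonneg (hrel := hrel) A
      (ofGraph φ rel (wordPath φ g (rel i).toWord (discAngle z)))
    rw [gauge, weight_ofGraph] at h1
    rw [realize, Set.mem_ofPred_eq, gauge, weight_face, if_neg hn] at h
    have h2 := mul_nonneg (norm_nonneg (z : ℂ)) h1
    linarith

variable {A B : Set (CayleyCell G S ι)}

lemma realize_union (hA : IsSubcomplex φ rel A) (hB : IsSubcomplex φ rel B) :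
    realize hrel (A ∪ B) = realize hrel A ∪ realize hrel B := by
  ext x
  obtain ⟨c, hc⟩ := exists_mem_openCell x
  rw [Set.mem_union, mem_realize_iff hA hc, mem_realize_iff hB hc, mem_realize_iff (hA.union hB) hc,
    Set.mem_union]

lemma realize_inter (hA : IsSubcomplex φ rel A) (hB : IsSubcomplex φ rel B) :
    realize hrel (A ∩ B) = realize hrel A ∩ realize hrel B := by
  ext x
  obtain ⟨c, hc⟩ := exists_mem_openCell x
  rw [Set.mem_inter_iff, mem_realize_iff hA hc, mem_realize_iff hB hc,
    mem_realize_iff (hA.inter hB) hc, Set.mem_inter_iff]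

lemma realize_mono (hA : IsSubcomplex φ rel A) (hB : IsSubcomplex φ rel B) (h : A ⊆ B) :
    realize hrel A ⊆ realize hrel B := by
  intro x
  obtain ⟨c, hc⟩ := exists_mem_openCell x
  rw [mem_realize_iff hA hc, mem_realize_iff hB hc]
  exact @h c

/-- Gluing of subcomplexes that are extensors. -/
lemma isExtensor_realize_union (hA : IsSubcomplex φ rel A) (hB : IsSubcomplex φ rel B)
    (hA' : IsExtensor (realize hrel A)) (hB' : IsExtensor (realize hrel B))
    (hAB : IsExtensor (realize hrel (A ∩ B))) : IsExtensor (realize hrel (A ∪ B)) := by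
  rw [realize_inter hA hB] at hAB
  rw [realize_union hA hB]
  -- Both gauges are nonnegative and on the union one of them is zero, so the sign of the difference
  -- tells to which part a point belongs.
  refine hA'.union hB' hAB (u := fun x ↦ gauge hrel A x - gauge hrel B x)
    ((continuous_gauge hrel A).sub (continuous_gauge hrel B)) (fun y hy ↦ ?_) (fun y hy ↦ ?_)
  · have h1 := gauge_nonneg (hrel := hrel) A y
    have h2 := gauge_nonneg (hrel := hrel) B y
    simp only [realize, Set.mem_union, Set.mem_ofPred_eq] at hy ⊢
    constructor
    · intro h
      linarith
    · intro h
      rcases hy with hy | hy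
      · exact hy
      · linarith
  · have h1 := gauge_nonneg (hrel := hrel) A y
    have h2 := gauge_nonneg (hrel := hrel) B y
    simp only [realize, Set.mem_union, Set.mem_ofPred_eq] at hy ⊢
    constructor
    · intro h
      linarith
    · intro h
      rcases hy with hy | hy
      · linarith
      · exact hy

lemma eq_vertex_of_mem_realize {g : G} {x : CayleyComplex φ rel}
    (hx : x ∈ realize hrel {vert g}) : x = ofGraph φ rel (vertex φ g) := by
  obtain ⟨c, hc⟩ := exists_mem_openCell x
  have hs : IsSubcomplex φ rel ({vert g} : Set (CayleyCell G S ι)) := isSubcomplex_trace g []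
  obtain rfl : c = vert g := (mem_realize_iff hs hc).1 hx
  exact hc

lemma isExtensor_realize_vert (g : G) :
    IsExtensor (realize (φ := φ) (rel := rel) hrel {vert g}) := by
  have : realize (φ := φ) (rel := rel) hrel {vert g} = {ofGraph φ rel (vertex φ g)} := by
    ext x
    refine ⟨eq_vertex_of_mem_realize, fun h ↦ ?_⟩
    rw [show x = _ from h]
    exact vertex_mem_realize.2 rfl
  rw [this]
  exact IsExtensor.singleton _

lemma range_letterPath (g : G) (a : S × Bool) :
    Set.range (fun t ↦ ofGraph φ rel (letterPath φ g a t)) =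
      realize hrel (letterTrace ι φ g a) := by
  refine Set.Subset.antisymm ?_ fun x hx ↦ ?_
  · rintro _ ⟨t, rfl⟩
    exact letterPath_mem_realize (isSubcomplex_letterTrace g a) subset_rfl t
  · obtain ⟨c, hc⟩ := exists_mem_openCell x
    rw [mem_realize_iff (isSubcomplex_letterTrace g a) hc] at hx
    obtain ⟨s, _ | _⟩ := a
    · rcases hx with rfl | rfl | rfl
      · exact ⟨0, by rw [show x = _ from hc]; simp⟩
      · exact ⟨1, by rw [show x = _ from hc]; simp⟩
      · obtain ⟨t, _, _, rfl⟩ := hc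
        exact ⟨unitInterval.symm t, by simp [letterPath]⟩
    · rcases hx with rfl | rfl | rfl
      · exact ⟨0, by rw [show x = _ from hc]; simp⟩
      · exact ⟨1, (congrArg _ (letterPath φ g (s, true)).target).trans (show x = _ from hc).symm⟩
      · obtain ⟨t, _, _, rfl⟩ := hc
        exact ⟨t, rfl⟩

lemma range_wordPath (g : G) (w : List (S × Bool)) :
    Set.range (fun t ↦ ofGraph φ rel (wordPath φ g w t)) = realize hrel (trace ι φ g w) := by
  induction w generalizing g with
  | nil =>
    ext x
    constructor
    · rintro ⟨t, rfl⟩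
      exact vertex_mem_realize.2 rfl
    · intro hx
      exact ⟨0, (eq_vertex_of_mem_realize hx).symm⟩
  | cons a w ih =>
    cases w with
    | nil =>
      have : trace ι φ g [a] = letterTrace ι φ g a := by
        refine Set.union_eq_left.2 (Set.singleton_subset_iff.2 ?_)
        obtain ⟨s, _ | _⟩ := a <;> exact Or.inr (Or.inl rfl)
      rw [this]
      exact range_letterPath g a
    | cons b w =>
      rw [trace, realize_union (isSubcomplex_letterTrace g a) (isSubcomplex_trace _ _),
        ← range_letterPath, ← ih]
      change Set.range (ofGraph φ rel ∘ _) = Set.range (ofGraph φ rel ∘ _) ∪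
        Set.range (ofGraph φ rel ∘ _)
      rw [Set.range_comp, Set.range_comp, Set.range_comp, ← Set.image_union]
      congr 1
      rw [wordPath, Path.cast_coe, Path.trans_range]

lemma range_face (g : G) (i : ι) : Set.range (face φ rel g i) =
    realize hrel (insert (twoCell g i) (trace ι φ g (rel i).toWord)) := by
  refine Set.Subset.antisymm ?_ fun x hx ↦ ?_
  · rintro _ ⟨z, rfl⟩
    exact face_mem_realize (isSubcomplex_insert_face g i) (Or.inl rfl) z
  · obtain ⟨c, hc⟩ := exists_mem_openCell x
    rcases (mem_realize_iff (isSubcomplex_insert_face g i) hc).1 hx with rfl | hc'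
    · obtain ⟨z, _, rfl⟩ := hc
      exact ⟨z, rfl⟩
    · rw [← mem_realize_iff (hrel := hrel) (isSubcomplex_trace _ _) hc, ← range_wordPath] at hc'
      obtain ⟨t, rfl⟩ := hc'
      exact ⟨discBoundary t, face_discBoundary φ rel g i t⟩

end

end CayleyComplex

end Cayley

/-! ### Embedded boundary paths, discs, and compact sets -/

open Topology

section Cayley

variable {G S ι : Type} [Group G]

namespace CayleyCell

/-- The edge path of a word is an embedded arc. -/
def IsArc (ι : Type) (φ : FreeGroup S →* G) : G → List (S × Bool) → Prop
  | _, [] => True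
  | g, a :: w => letterTrace ι φ g a ∩ trace ι φ (g * φ (FreeGroup.mk [a])) w =
      {vert (g * φ (FreeGroup.mk [a]))} ∧ IsArc ι φ (g * φ (FreeGroup.mk [a])) w

/-- The edge path of a word is an embedded circle. -/
def IsCircle (ι : Type) (φ : FreeGroup S →* G) : G → List (S × Bool) → Prop
  | _, [] => False
  | g, a :: w => w ≠ [] ∧ letterTrace ι φ g a ∩ trace ι φ (g * φ (FreeGroup.mk [a])) w =
      {vert g, vert (g * φ (FreeGroup.mk [a]))} ∧ IsArc ι φ (g * φ (FreeGroup.mk [a])) w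

variable [DecidableEq S]

/-- The cells of a closed cell. -/
def closedCell (φ : FreeGroup S →* G) (rel : ι → FreeGroup S) :
    CayleyCell G S ι → Set (CayleyCell G S ι)
  | vert g => {vert g}
  | oneCell g s => letterTrace ι φ g (s, true)
  | twoCell g i => insert (twoCell g i) (trace ι φ g (rel i).toWord)

variable {φ : FreeGroup S →* G} {rel : ι → FreeGroup S}

lemma isSubcomplex_closedCell (c : CayleyCell G S ι) :
    IsSubcomplex φ rel (closedCell φ rel c) := by
  cases c with
  | vert g => exact isSubcomplex_trace (φ := φ) (rel := rel) g []
  | oneCell g s => exact isSubcomplex_letterTrace g (s, true)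
  | twoCell g i => exact isSubcomplex_insert_face (φ := φ) (rel := rel) g i

lemma mem_closedCell_self (c : CayleyCell G S ι) : c ∈ closedCell φ rel c := by
  cases c with
  | vert g => exact Set.mem_singleton _
  | oneCell g s => exact Or.inr (Or.inr rfl)
  | twoCell g i => exact Or.inl rfl

lemma finite_closedCell (c : CayleyCell G S ι) : (closedCell φ rel c).Finite := by
  cases c with
  | vert g => exact Set.finite_singleton _
  | oneCell g s => exact (finite_trace g [(s, true)]).subset Set.subset_union_left
  | twoCell g i => exact (finite_trace g _).insert _

omit [DecidableEq S] in
lemma twoCell_notMem_trace (g g' : G) (i : ι) (w : List (S × Bool)) :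
    twoCell g i ∉ trace ι φ g' w := by
  induction w generalizing g' with
  | nil => simp [trace]
  | cons a w ih =>
    obtain ⟨s, _ | _⟩ := a <;> simp [trace, letterTrace, ih]

/-- Two cells in each other's closure have the same dimension, and the only top-dimensional cell of
a closed cell is the cell itself. This makes the open cells disjoint. -/
lemma eq_of_mem_closedCell {c c' : CayleyCell G S ι} (h : c ∈ closedCell φ rel c')
    (h' : c' ∈ closedCell φ rel c) : c = c' := by
  cases c <;> cases c' <;>
    simp_all [closedCell, letterTrace, twoCell_notMem_trace]

lemma IsSubcomplex.iUnion {J : Type*} {A : J → Set (CayleyCell G S ι)}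
    (hA : ∀ j, IsSubcomplex φ rel (A j)) : IsSubcomplex φ rel (⋃ j, A j) where
  left_mem h := by
    obtain ⟨j, h⟩ := Set.mem_iUnion.1 h
    exact Set.mem_iUnion.2 ⟨j, (hA j).left_mem h⟩
  right_mem h := by
    obtain ⟨j, h⟩ := Set.mem_iUnion.1 h
    exact Set.mem_iUnion.2 ⟨j, (hA j).right_mem h⟩
  trace_subset h := by
    obtain ⟨j, h⟩ := Set.mem_iUnion.1 h
    exact ((hA j).trace_subset h).trans (Set.subset_iUnion _ _)

end CayleyCell

namespace CayleyComplex

open CayleyGraph CayleyCell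

variable [DecidableEq S] {φ : FreeGroup S →* G} {rel : ι → FreeGroup S}
  {hrel : ∀ i, φ (rel i) = 1}

include hrel in
lemma ofGraph_edge_injective (hφ : ∀ s, φ (FreeGroup.of s) ≠ 1) (g : G) (s : S) :
    Function.Injective fun t ↦ ofGraph φ rel (edge φ g s t) := by
  intro t t' h
  have h' := congrArg (weight hrel (vertexBump g) 0 0) h
  have hb : vertexBump g (g * φ (FreeGroup.of s)) = 0 := if_neg fun h ↦ hφ s (mul_eq_left.1 h)
  simp only [weight_ofGraph, weight_edge, vertexBump_self, hb, Pi.zero_apply] at h'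
  apply Subtype.ext
  linarith

include hrel in
lemma ofGraph_letterPath_injective (hφ : ∀ s, φ (FreeGroup.of s) ≠ 1) (g : G) (a : S × Bool) :
    Function.Injective fun t ↦ ofGraph φ rel (letterPath φ g a t) := by
  obtain ⟨s, _ | _⟩ := a
  · exact (ofGraph_edge_injective (hrel := hrel) hφ _ s).comp unitInterval.symm_bijective.injective
  · exact ofGraph_edge_injective (hrel := hrel) hφ g s

/-- If one of the edge paths of a letter and of a word lies on the other, then the point is in the
realization of the intersection. -/
lemma mem_realize_inter_of_eq {g g' : G} {a : S × Bool} {w : List (S × Bool)} {t t' : unitInterval}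
    (h : ofGraph φ rel (letterPath φ g a t) = ofGraph φ rel (wordPath φ g' w t')) :
    ofGraph φ rel (letterPath φ g a t) ∈
      realize hrel (letterTrace ι φ g a ∩ trace ι φ g' w) := by
  rw [realize_inter (isSubcomplex_letterTrace g a) (isSubcomplex_trace g' w)]
  refine ⟨letterPath_mem_realize (isSubcomplex_letterTrace g a) subset_rfl t, ?_⟩
  rw [h]
  exact wordPath_mem_realize (isSubcomplex_trace g' w) subset_rfl t'

include hrel in
lemma ofGraph_wordPath_injective (hφ : ∀ s, φ (FreeGroup.of s) ≠ 1) {g : G} {w : List (S × Bool)}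
    (hw : w ≠ []) (ha : IsArc ι φ g w) :
    Function.Injective fun t ↦ ofGraph φ rel (wordPath φ g w t) := by
  induction w generalizing g with
  | nil => exact absurd rfl hw
  | cons a w ih =>
    cases w with
    | nil => exact ofGraph_letterPath_injective (hrel := hrel) hφ g a
    | cons b w =>
      have hL := ofGraph_letterPath_injective (hrel := hrel) hφ g a
      have hR := ih (List.cons_ne_nil b w) ha.2
      -- The first edge and the remaining path share only their common vertex, which the remaining
      -- path meets only at time 0. In the concatenation this excludes a coincidence between a time
      -- at most 1/2 and a time greater than 1/2.
      have key (t t' : unitInterval) (h : ofGraph φ rel (letterPath φ g a t) =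
          ofGraph φ rel (wordPath φ (g * φ (FreeGroup.mk [a])) (b :: w) t')) : t' = 0 := by
        have h1 := mem_realize_inter_of_eq (hrel := hrel) h
        rw [ha.1] at h1
        have h2 := eq_vertex_of_mem_realize h1
        apply hR
        change ofGraph φ rel _ = ofGraph φ rel _
        rw [← h, h2, Path.source]
      intro t t' h
      simp only [wordPath, Path.cast_coe, Path.trans_apply] at h
      split_ifs at h with h1 h2 h2
      · have := congrArg Subtype.val (hL h)
        apply Subtype.ext
        simp only at this
        linarith
      · have := congrArg Subtype.val (key _ _ h)
        simp only [Set.Icc.coe_zero] at this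
        linarith
      · have := congrArg Subtype.val (key _ _ h.symm)
        simp only [Set.Icc.coe_zero] at this
        linarith
      · have := congrArg Subtype.val (hR h)
        apply Subtype.ext
        simp only at this
        linarith

include hrel in
-- The first edge and the rest of the circle are two arcs that share only their endpoints. One
-- common endpoint is the junction at time 1/2, the other is the base point, reached at times 0 and
-- 1.
lemma ofGraph_wordPath_eq_iff (hφ : ∀ s, φ (FreeGroup.of s) ≠ 1) {g : G} {w : List (S × Bool)}
    (hw : φ (FreeGroup.mk w) = 1) (hc : IsCircle ι φ g w) {t t' : unitInterval}
    (h : ofGraph φ rel (wordPath φ g w t) = ofGraph φ rel (wordPath φ g w t')) :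
    t = t' ∨ t = 0 ∧ t' = 1 ∨ t = 1 ∧ t' = 0 := by
  match w, hw, hc with
  | [a], _, hc => exact absurd rfl hc.1
  | a :: b :: w, hw, hc =>
    obtain ⟨-, hi, ha⟩ := hc
    have hL := ofGraph_letterPath_injective (hrel := hrel) hφ g a
    have hR := ofGraph_wordPath_injective (hrel := hrel) hφ (List.cons_ne_nil b w) ha
    have hend : g * φ (FreeGroup.mk [a]) * φ (FreeGroup.mk (b :: w)) = g := by
      rw [mul_assoc, ← map_mul, FreeGroup.mul_mk, List.singleton_append, hw, mul_one]
    have key (t t' : unitInterval) (h : ofGraph φ rel (letterPath φ g a t) =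
        ofGraph φ rel (wordPath φ (g * φ (FreeGroup.mk [a])) (b :: w) t')) :
        t' = 0 ∨ t = 0 ∧ t' = 1 := by
      have h1 := mem_realize_inter_of_eq (hrel := hrel) h
      have hs (g : G) : IsSubcomplex φ rel ({vert g} : Set (CayleyCell G S ι)) :=
        isSubcomplex_trace g []
      rw [hi, Set.insert_eq, realize_union (hs _) (hs _)] at h1
      rcases h1 with h1 | h1
      · right
        have h2 := eq_vertex_of_mem_realize h1
        constructor
        · apply hL
          change ofGraph φ rel _ = ofGraph φ rel _
          rw [h2, Path.source]
        · apply hR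
          change ofGraph φ rel _ = ofGraph φ rel _
          rw [← h, h2, Path.target, hend]
      · left
        have h2 := eq_vertex_of_mem_realize h1
        apply hR
        change ofGraph φ rel _ = ofGraph φ rel _
        rw [← h, h2, Path.source]
    simp only [wordPath, Path.cast_coe, Path.trans_apply] at h
    split_ifs at h with h1 h2 h2
    · have := congrArg Subtype.val (hL h)
      left
      apply Subtype.ext
      simp only at this
      linarith
    · rcases key _ _ h with h3 | ⟨h3, h4⟩
      · have := congrArg Subtype.val h3
        simp only [Set.Icc.coe_zero] at this
        linarith
      · have h3 := congrArg Subtype.val h3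
        have h4 := congrArg Subtype.val h4
        simp only [Set.Icc.coe_zero, Set.Icc.coe_one] at h3 h4
        right; left
        constructor <;> apply Subtype.ext <;> simp only [Set.Icc.coe_zero, Set.Icc.coe_one] <;>
          linarith
    · rcases key _ _ h.symm with h3 | ⟨h3, h4⟩
      · have := congrArg Subtype.val h3
        simp only [Set.Icc.coe_zero] at this
        linarith
      · have h3 := congrArg Subtype.val h3
        have h4 := congrArg Subtype.val h4
        simp only [Set.Icc.coe_zero, Set.Icc.coe_one] at h3 h4
        right; right
        constructor <;> apply Subtype.ext <;> simp only [Set.Icc.coe_zero, Set.Icc.coe_one] <;>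
          linarith
    · have := congrArg Subtype.val (hR h)
      left
      apply Subtype.ext
      simp only at this
      linarith

include hrel in
-- The bump of the face recovers the radius r. For r < 1 the face coordinate (1 - r) z then recovers
-- z; on the boundary circle injectivity is that of the attaching path.
lemma face_injective (hφ : ∀ s, φ (FreeGroup.of s) ≠ 1) {g : G} {i : ι}
    (hc : IsCircle ι φ g (rel i).toWord) : Function.Injective (face φ rel g i) := by
  intro z z' h
  have h1 := congrArg (weight hrel 0 0 (cellBump g i)) h
  simp only [weight_zero_face, cellBump_self, mul_one] at h1
  have h2 := congrArg (faceCoord g i) h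
  rw [faceCoord_face, faceCoord_face, ← h1] at h2
  rcases (mem_closedBall_zero_iff.1 z.2).lt_or_eq with hz | hz
  · have : (((1 - ‖(z : ℂ)‖ : ℝ)) : ℂ) ≠ 0 := by
      exact_mod_cast (sub_pos.2 hz).ne'
    exact Subtype.ext (mul_left_cancel₀ this h2)
  · have hz' : ‖(z' : ℂ)‖ = 1 := by linarith
    rw [← discBoundary_discAngle hz, ← discBoundary_discAngle hz', face_discBoundary,
      face_discBoundary] at h
    rw [← discBoundary_discAngle hz, ← discBoundary_discAngle hz', discBoundary_eq_iff]
    exact ofGraph_wordPath_eq_iff (hrel := hrel) hφ (by rw [FreeGroup.mk_toWord, hrel]) hc h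

lemma isExtensor_letterTrace (hφ : ∀ s, φ (FreeGroup.of s) ≠ 1) (g : G) (a : S × Bool) :
    IsExtensor (realize (φ := φ) (rel := rel) hrel (letterTrace ι φ g a)) := by
  have := t2Space hrel hφ
  rw [← range_letterPath]
  exact IsExtensor.range ((continuous_ofGraph φ rel).comp (letterPath φ g a).continuous)
    (ofGraph_letterPath_injective (hrel := hrel) hφ g a)

lemma isExtensor_trace (hφ : ∀ s, φ (FreeGroup.of s) ≠ 1) {g : G} {w : List (S × Bool)}
    (ha : IsArc ι φ g w) :
    IsExtensor (realize (φ := φ) (rel := rel) hrel (trace ι φ g w)) := by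
  induction w generalizing g with
  | nil => exact isExtensor_realize_vert g
  | cons a w ih =>
    refine isExtensor_realize_union (isSubcomplex_letterTrace g a) (isSubcomplex_trace _ w)
      (isExtensor_letterTrace hφ g a) (ih ha.2) ?_
    rw [ha.1]
    exact isExtensor_realize_vert _

lemma isExtensor_face (hφ : ∀ s, φ (FreeGroup.of s) ≠ 1) {g : G} {i : ι}
    (hc : IsCircle ι φ g (rel i).toWord) : IsExtensor (realize (φ := φ) (rel := rel) hrel
      (insert (twoCell g i) (trace ι φ g (rel i).toWord))) := by
  have := t2Space hrel hφ
  rw [← range_face]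
  have : TietzeExtension.{0, 0} (Metric.closedBall (0 : ℂ) 1) :=
    Set.instTietzeExtensionUnitClosedBall (𝕜 := ℂ)
  exact IsExtensor.range (continuous_face φ rel g i) (face_injective (hrel := hrel) hφ hc)

/-! ### Compact subsets -/

include hrel in
lemma eq_of_mem_openCell {c c' : CayleyCell G S ι} {x : CayleyComplex φ rel}
    (h : x ∈ openCell φ rel c) (h' : x ∈ openCell φ rel c') : c = c' := by
  refine eq_of_mem_closedCell (φ := φ) (rel := rel) ?_ ?_
  · rw [← mem_realize_iff (hrel := hrel) (isSubcomplex_closedCell c') h,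
      mem_realize_iff (isSubcomplex_closedCell c') h']
    exact mem_closedCell_self c'
  · rw [← mem_realize_iff (hrel := hrel) (isSubcomplex_closedCell c) h',
      mem_realize_iff (isSubcomplex_closedCell c) h]
    exact mem_closedCell_self c

include hrel in
/-- A compact set meets only finitely many open cells. -/
lemma finite_of_isCompact (hφ : ∀ s, φ (FreeGroup.of s) ≠ 1) {K : Set (CayleyComplex φ rel)}
    (hK : IsCompact K) : {c | (K ∩ openCell φ rel c).Nonempty}.Finite := by
  have := t2Space hrel hφ
  let Z := {c | (K ∩ openCell φ rel c).Nonempty}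
  -- One point is chosen in each open cell that K meets. Every set of chosen points has finite
  -- intersection with each closed cell, hence is closed. So the chosen points form a closed
  -- discrete subset of a compact set, which is finite.
  choose x hx using fun c : Z ↦ c.2
  have hfin (A : Set (CayleyCell G S ι)) (hA : IsSubcomplex φ rel A) (hA' : A.Finite)
      (Q : Set (CayleyComplex φ rel)) (hQ : Q ⊆ Set.range x) : (Q ∩ realize hrel A).Finite := by
    have : (x '' {c : Z | (c : CayleyCell G S ι) ∈ A}).Finite :=
      (hA'.preimage Subtype.val_injective.injOn).image x
    refine this.subset ?_
    rintro y ⟨hy, hyA⟩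
    obtain ⟨c, rfl⟩ := hQ hy
    exact ⟨c, (mem_realize_iff hA (hx c).2).1 hyA, rfl⟩
  have hclosed (Q : Set (CayleyComplex φ rel)) (hQ : Q ⊆ Set.range x) : IsClosed Q := by
    refine isClosed_of_cells (fun g s ↦ ?_) (fun g i ↦ ?_)
    · have h1 := (hfin _ (isSubcomplex_closedCell (oneCell g s)) (finite_closedCell _) Q
        hQ).isClosed.preimage ((continuous_ofGraph φ rel).comp (edge φ g s).continuous)
      convert h1 using 1
      ext t
      refine ⟨fun h ↦ ⟨h, ?_⟩, fun h ↦ h.1⟩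
      exact edge_mem_realize (isSubcomplex_closedCell _) (mem_closedCell_self (oneCell g s)) t
    · have h1 := (hfin _ (isSubcomplex_closedCell (twoCell g i)) (finite_closedCell _) Q
        hQ).isClosed.preimage (continuous_face φ rel g i)
      convert h1 using 1
      ext z
      refine ⟨fun h ↦ ⟨h, ?_⟩, fun h ↦ h.1⟩
      exact face_mem_realize (isSubcomplex_closedCell _) (mem_closedCell_self (twoCell g i)) z
  have hd : DiscreteTopology (Set.range x) := by
    refine discreteTopology_iff_forall_isClosed.2 fun s ↦ ?_
    have h1 := (hclosed (Subtype.val '' s) (Subtype.coe_image_subset _ s)).preimage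
      (continuous_subtype_val (p := (· ∈ Set.range x)))
    rwa [Set.preimage_image_eq _ Subtype.val_injective] at h1
  have hr : (Set.range x).Finite := by
    refine IsCompact.finite (hK.of_isClosed_subset (hclosed _ subset_rfl) ?_) ⟨hd⟩
    rintro _ ⟨c, rfl⟩
    exact (hx c).1
  have hinj : Function.Injective x := fun c c' h ↦
    Subtype.ext (eq_of_mem_openCell (hrel := hrel) (hx c).2 (h ▸ (hx c').2))
  have : Finite Z := (Set.finite_range_iff hinj).1 hr
  exact Set.toFinite Z

/-- Directed unions of subcomplexes that are extensors are extensors. -/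
lemma isExtensor_realize_iUnion (hφ : ∀ s, φ (FreeGroup.of s) ≠ 1) {J : Type} [Nonempty J]
    {A : J → Set (CayleyCell G S ι)} (hd : Directed (· ⊆ ·) A)
    (hA : ∀ j, IsSubcomplex φ rel (A j)) (hA' : ∀ j, IsExtensor (realize hrel (A j))) :
    IsExtensor (realize hrel (⋃ j, A j)) := by
  refine IsExtensor.of_isCompact fun K hK hKA ↦ ?_
  have hf := finite_of_isCompact (hrel := hrel) hφ hK
  obtain ⟨j, hj⟩ := hd.exists_mem_subset_of_finset_subset_biUnion (s := hf.toFinset) (by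
    intro c hc
    simp only [Set.Finite.coe_toFinset, Set.mem_ofPred_eq] at hc
    obtain ⟨x, hxK, hxc⟩ := hc
    exact (mem_realize_iff (IsSubcomplex.iUnion hA) hxc).1 (hKA hxK))
  refine ⟨realize hrel (A j), fun x hx ↦ ?_,
    realize_mono (hA j) (IsSubcomplex.iUnion hA) (Set.subset_iUnion _ _), hA' j⟩
  obtain ⟨c, hc⟩ := exists_mem_openCell x
  exact (mem_realize_iff (hA j) hc).2 (hj (by simpa using ⟨x, hx, hc⟩))

end CayleyComplex

end Cayley

/-! ### Contractibility -/

/-- The map on X × {0, 1} ∪ B × I given by `f`, the constant `y` and `h` is defined on a closed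
subset of the compact Hausdorff space X × I, so it extends. The result is curried so that such
homotopies can be glued over the cells of a complex. -/
lemma IsExtensor.exists_homotopy_extension {Y : Type} [TopologicalSpace Y]
    (hY : IsExtensor (Set.univ : Set Y)) {X : Type} [TopologicalSpace X] [CompactSpace X] [T2Space X]
    {B : Set X} (hB : IsClosed B) {f : X → Y} (hf : Continuous f) {h : X → unitInterval → Y}
    (hh : ContinuousOn (fun x : X × unitInterval ↦ h x.1 x.2) (B ×ˢ Set.univ)) {y : Y}
    (h0 : ∀ x ∈ B, h x 0 = f x) (h1 : ∀ x ∈ B, h x 1 = y) :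
    ∃ F : C(X, C(unitInterval, Y)),
      (∀ x, F x 0 = f x) ∧ (∀ x, F x 1 = y) ∧ ∀ x ∈ B, ∀ t, F x t = h x t := by
  classical
  let C0 : Set (X × unitInterval) := {x | x.2 = 0}
  let C1 : Set (X × unitInterval) := {x | x.2 = 1}
  have hC0 : IsClosed C0 := isClosed_eq continuous_snd continuous_const
  have hC1 : IsClosed C1 := isClosed_eq continuous_snd continuous_const
  have hC2 : IsClosed (B ×ˢ (Set.univ : Set unitInterval)) := hB.prod isClosed_univ
  let k : X × unitInterval → Y := fun x ↦ if x.2 = 0 then f x.1 else if x.2 = 1 then y else h x.1 x.2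
  have k0 : Set.EqOn k (fun x ↦ f x.1) C0 := fun x hx ↦ if_pos hx
  have k1 : Set.EqOn k (fun _ ↦ y) C1 := fun x hx ↦ by
    have hx : x.2 = 1 := hx
    simp [k, hx]
  have k2 : Set.EqOn k (fun x ↦ h x.1 x.2) (B ×ˢ Set.univ) := fun x hx ↦ by
    dsimp only [k]
    split_ifs with e0 e1
    · rw [e0, h0 _ hx.1]
    · rw [e1, h1 _ hx.1]
    · rfl
  have kc : ContinuousOn k (C0 ∪ C1 ∪ B ×ˢ Set.univ) :=
    ContinuousOn.union_of_isClosed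
      (ContinuousOn.union_of_isClosed ((hf.comp continuous_fst).continuousOn.congr k0)
        (continuousOn_const.congr k1) hC0 hC1) (hh.congr k2) (hC0.union hC1) hC2
  obtain ⟨F, hF, -, hFe⟩ := hY _ _ k ((hC0.union hC1).union hC2) kc (Set.mapsTo_univ _ _)
  refine ⟨ContinuousMap.curry ⟨F, hF⟩, fun x ↦ ?_, fun x ↦ ?_, fun x hx t ↦ ?_⟩
  · exact (hFe (Or.inl (Or.inl rfl))).trans (k0 rfl)
  · exact (hFe (Or.inl (Or.inr rfl))).trans (k1 rfl)
  · exact (hFe (Or.inr ⟨hx, trivial⟩)).trans (k2 ⟨hx, trivial⟩)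

namespace CayleyComplex

open CayleyGraph

variable {G S ι : Type} [Group G] [DecidableEq S] {φ : FreeGroup S →* G} {rel : ι → FreeGroup S}

/-- Paths from the vertices to a base point are extended to homotopies over the edges and then over
the faces, always relative to the boundary. Homotopies are treated as maps into the space of paths,
so that continuity can be checked cell by cell without the product of a quotient map with the
interval. -/
theorem contractibleSpace_of_isExtensor (hrel : ∀ i, φ (rel i) = 1)
    (h : IsExtensor (Set.univ : Set (CayleyComplex φ rel))) :
    ContractibleSpace (CayleyComplex φ rel) := by
  let y : CayleyComplex φ rel := ofGraph φ rel (vertex φ 1)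
  have h0 (g : G) : ∃ F : C(unitInterval, CayleyComplex φ rel),
      F 0 = ofGraph φ rel (vertex φ g) ∧ F 1 = y := by
    obtain ⟨F, hF0, hF1, -⟩ := h.exists_homotopy_extension (X := Unit) (B := ∅) isClosed_empty
      (f := fun _ ↦ ofGraph φ rel (vertex φ g)) continuous_const (h := fun _ _ ↦ y) (y := y)
      continuousOn_const (by simp) (by simp)
    exact ⟨F (), hF0 _, hF1 _⟩
  choose γ hγ0 hγ1 using h0
  have h1 (g : G) (s : S) : ∃ F : C(unitInterval, C(unitInterval, CayleyComplex φ rel)),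
      (∀ t, F t 0 = ofGraph φ rel (edge φ g s t)) ∧ (∀ t, F t 1 = y) ∧
        F 0 = γ g ∧ F 1 = γ (g * φ (FreeGroup.of s)) := by
    classical
    obtain ⟨F, hF0, hF1, hF⟩ := h.exists_homotopy_extension (X := unitInterval) (B := {0} ∪ {1})
      (isClosed_singleton.union isClosed_singleton)
      (f := fun t ↦ ofGraph φ rel (edge φ g s t))
      ((continuous_ofGraph φ rel).comp (edge φ g s).continuous)
      (h := fun t ↦ if t = 0 then γ g else γ (g * φ (FreeGroup.of s))) (y := y)
      (by
        rw [Set.union_prod]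
        refine ContinuousOn.union_of_isClosed ?_ ?_ (isClosed_singleton.prod isClosed_univ)
          (isClosed_singleton.prod isClosed_univ)
        · refine ((γ g).continuous.comp continuous_snd).continuousOn.congr fun x hx ↦ ?_
          have : x.1 = 0 := hx.1
          simp [this]
        · refine ((γ (g * φ (FreeGroup.of s))).continuous.comp
            continuous_snd).continuousOn.congr fun x hx ↦ ?_
          have : x.1 = 1 := hx.1
          simp [this])
      (by
        rintro _ (rfl | rfl)
        · simp [hγ0]
        · simp [hγ0])
      (by
        rintro _ (rfl | rfl)
        · simp [hγ1]
        · simp [hγ1])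
    refine ⟨F, hF0, hF1, ?_, ?_⟩
    · ext t
      rw [hF 0 (Or.inl rfl), if_pos rfl]
    · ext t
      rw [hF 1 (Or.inr rfl), if_neg one_ne_zero]
  choose F1 hF10 hF11 hF1l hF1r using h1
  let H1 : CayleyGraph φ → C(unitInterval, CayleyComplex φ rel) :=
    CayleyGraph.lift γ (fun g s t ↦ F1 g s t) hF1l hF1r
  have hH1 : Continuous H1 := CayleyGraph.continuous_of_cells fun g s ↦ (F1 g s).continuous
  have hH10 (x : CayleyGraph φ) : H1 x 0 = ofGraph φ rel x := by
    induction x using CayleyGraph.ind with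
    | h0 g => exact hγ0 g
    | h1 g s t => exact hF10 g s t
  have hH11 (x : CayleyGraph φ) : H1 x 1 = y := by
    induction x using CayleyGraph.ind with
    | h0 g => exact hγ1 g
    | h1 g s t => exact hF11 g s t
  have h2 (g : G) (i : ι) :
      ∃ F : C(Metric.closedBall (0 : ℂ) 1, C(unitInterval, CayleyComplex φ rel)),
        (∀ z, F z 0 = face φ rel g i z) ∧ (∀ z, F z 1 = y) ∧
          ∀ t, F (discBoundary t) = H1 (wordPath φ g (rel i).toWord t) := by
    let p : unitInterval → C(unitInterval, CayleyComplex φ rel) :=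
      fun t ↦ H1 (wordPath φ g (rel i).toWord t)
    have hp : Continuous p := hH1.comp (Path.continuous _)
    have hp01 : p 0 = p 1 := congrArg H1 (wordPath_loop hrel g i)
    obtain ⟨F, hF0, hF1, hF⟩ := h.exists_homotopy_extension
      (X := Metric.closedBall (0 : ℂ) 1) (B := {z | ‖(z : ℂ)‖ = 1})
      (isClosed_eq (by fun_prop) continuous_const)
      (continuous_face φ rel g i) (h := fun z ↦ p (discAngle z)) (y := y)
      (by
        have e1 := (continuousOn_comp_discAngle hp hp01).comp
          (continuous_fst (X := Metric.closedBall (0 : ℂ) 1) (Y := unitInterval)).continuousOn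
          (s := {z : Metric.closedBall (0 : ℂ) 1 | ‖(z : ℂ)‖ = 1} ×ˢ Set.univ)
          (fun x hx ↦ hx.1)
        exact continuous_eval.comp_continuousOn (e1.prodMk continuous_snd.continuousOn))
      (fun z hz ↦ by
        rw [← discBoundary_discAngle hz, face_discBoundary,
          apply_discAngle_discBoundary p hp01]
        exact hH10 _)
      (fun z hz ↦ hH11 _)
    refine ⟨F, hF0, hF1, fun t ↦ ?_⟩
    ext τ
    rw [hF _ (norm_discBoundary t), apply_discAngle_discBoundary p hp01]
  choose F2 hF20 hF21 hF2 using h2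
  let H2 : CayleyComplex φ rel → C(unitInterval, CayleyComplex φ rel) :=
    lift H1 (fun g i z ↦ F2 g i z) hF2
  have hH2 : Continuous H2 := continuous_of_cells hH1 fun g i ↦ (F2 g i).continuous
  rw [contractible_iff_id_nullhomotopic]
  refine ⟨y, ⟨⟨⟨fun x ↦ H2 x.2 x.1, ?_⟩, fun x ↦ ?_, fun x ↦ ?_⟩⟩⟩
  · fun_prop
  · change H2 x 0 = x
    induction x using ind with
    | h1 x => exact hH10 x
    | h2 g i z => exact hF20 g i z
  · change H2 x 1 = y
    induction x using ind with
    | h1 x => exact hH11 x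
    | h2 g i z => exact hF21 g i z

end CayleyComplex

/-! ### Prefix-closed sets of free groups -/

namespace FreeGroup

variable {α : Type} [DecidableEq α]

/-- The element whose reduced word is obtained by deleting the last letter. -/
def parent (x : FreeGroup α) : FreeGroup α := mk x.toWord.dropLast

lemma toWord_parent (x : FreeGroup α) : x.parent.toWord = x.toWord.dropLast := by
  rw [parent, toWord_mk]
  exact (isReduced_toWord.infix (List.dropLast_prefix _).isInfix).reduce_eq

lemma norm_parent_lt {x : FreeGroup α} (hx : x ≠ 1) : x.parent.norm < x.norm := by
  have : x.toWord ≠ [] := fun h ↦ hx (toWord_eq_nil_iff.1 h)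
  rw [norm, norm, toWord_parent, List.length_dropLast]
  have := List.length_pos_iff.2 this
  omega

/-- Each element is obtained from its parent by multiplication with a letter. -/
lemma exists_parent_mul {x : FreeGroup α} (hx : x ≠ 1) :
    ∃ a : α × Bool, x.parent * mk [a] = x := by
  have h : x.toWord ≠ [] := fun h ↦ hx (toWord_eq_nil_iff.1 h)
  refine ⟨x.toWord.getLast h, ?_⟩
  rw [parent, mul_mk, List.dropLast_append_getLast, mk_toWord]

lemma parent_eq_of_append {x y : FreeGroup α} {a : α × Bool} (h : y.toWord = x.toWord ++ [a]) :
    y.parent = x := by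
  rw [parent, h, List.dropLast_concat, mk_toWord]

/-- Of two adjacent elements, one is the parent of the other. -/
lemma parent_eq_or (x : FreeGroup α) (a : α × Bool) :
    (x * mk [a]).parent = x ∨ x.parent = x * mk [a] := by
  -- Either the letter can be appended without cancellation, or it cancels the last letter of the
  -- reduced word.
  by_cases hx : IsReduced (x.toWord ++ [a])
  · left
    apply parent_eq_of_append (a := a)
    conv_lhs => rw [← mk_toWord (x := x), mul_mk, toWord_mk, hx.reduce_eq]
  · right
    have hx1 : x ≠ 1 := by
      rintro rfl
      exact hx (by simp)
    obtain ⟨b, hb⟩ := exists_parent_mul hx1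
    have hw : x.toWord = x.parent.toWord ++ [b] := by
      have h : x.toWord ≠ [] := fun h ↦ hx1 (toWord_eq_nil_iff.1 h)
      have h2 := List.dropLast_append_getLast h
      rw [toWord_parent]
      have h3 : mk [b] = mk [x.toWord.getLast h] := by
        apply mul_left_cancel (a := x.parent)
        rw [hb, parent, mul_mk, h2, mk_toWord]
      have h4 := congrArg toWord h3
      rw [toWord_mk, toWord_mk, reduce_singleton, reduce_singleton] at h4
      rw [h4, h2]
    have hab : b.1 = a.1 ∧ b.2 ≠ a.2 := by
      by_contra hn
      apply hx
      have hr : IsReduced x.toWord := isReduced_toWord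
      rw [hw] at hr ⊢
      refine hr.append_overlap ?_ (List.cons_ne_nil b [])
      simp only [IsReduced, List.cons_append, List.nil_append, List.isChain_cons_cons,
        List.isChain_singleton, and_true]
      intro h
      by_contra h'
      exact hn ⟨h, h'⟩
    have h5 : mk [b] * mk [a] = 1 := by
      obtain ⟨b1, b2⟩ := b
      obtain ⟨a1, a2⟩ := a
      obtain ⟨rfl, h⟩ := hab
      have : b2 = !a2 := by
        simp only at h
        cases a2 <;> cases b2 <;> simp_all
      subst this
      rw [mul_mk]
      exact Quot.sound (Red.Step.cons_not_rev)
    rw [← mul_one x.parent, ← h5, ← mul_assoc, hb]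

lemma mk_singleton_injective : Function.Injective fun a : α × Bool ↦ mk [a] := by
  intro a b h
  have := congrArg toWord h
  simpa [toWord_mk] using this

/-- Sets that contain the identity and with each element its parent. -/
structure IsPrefixClosed (A : Finset (FreeGroup α)) : Prop where
  one_mem : 1 ∈ A
  parent_mem {x} : x ∈ A → x.parent ∈ A

lemma isPrefixClosed_singleton_one : IsPrefixClosed ({1} : Finset (FreeGroup α)) where
  one_mem := Finset.mem_singleton_self 1
  parent_mem h := by
    rw [Finset.mem_singleton.1 h]
    exact Finset.mem_singleton_self 1

lemma IsPrefixClosed.insert {A : Finset (FreeGroup α)} (hA : IsPrefixClosed A) {b : FreeGroup α}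
    (hb : b.parent ∈ A) : IsPrefixClosed (insert b A) where
  one_mem := Finset.mem_insert_of_mem hA.one_mem
  parent_mem h := by
    rcases Finset.mem_insert.1 h with rfl | h
    · exact Finset.mem_insert_of_mem hb
    · exact Finset.mem_insert_of_mem (hA.parent_mem h)

lemma IsPrefixClosed.union {A B : Finset (FreeGroup α)} (hA : IsPrefixClosed A)
    (hB : IsPrefixClosed B) : IsPrefixClosed (A ∪ B) where
  one_mem := Finset.mem_union_left _ hA.one_mem
  parent_mem h := by
    rcases Finset.mem_union.1 h with h | h
    · exact Finset.mem_union_left _ (hA.parent_mem h)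
    · exact Finset.mem_union_right _ (hB.parent_mem h)

lemma exists_isPrefixClosed_mem (x : FreeGroup α) :
    ∃ A : Finset (FreeGroup α), IsPrefixClosed A ∧ x ∈ A := by
  by_cases hx : x = 1
  · exact ⟨{1}, isPrefixClosed_singleton_one, by simp [hx]⟩
  · have := norm_parent_lt hx
    obtain ⟨A, hA, h⟩ := exists_isPrefixClosed_mem x.parent
    exact ⟨insert x A, hA.insert h, Finset.mem_insert_self x A⟩
termination_by x.norm

/-- Prefix-closed finite sets are built up by adding elements with parent in the set. -/
lemma IsPrefixClosed.induction {P : Finset (FreeGroup α) → Prop} (h1 : P {1})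
    (h2 : ∀ A b, IsPrefixClosed A → b ∉ A → b.parent ∈ A → P A → P (Insert.insert b A))
    {A : Finset (FreeGroup α)} (hA : IsPrefixClosed A) : P A := by
  induction hn : A.card generalizing A with
  | zero => exact absurd hA.one_mem (by simp [Finset.card_eq_zero.1 hn])
  | succ n ih =>
    by_cases hA1 : A = {1}
    · rwa [hA1]
    -- A longest element is nobody's parent within `A`, so its removal leaves a prefix-closed set.
    obtain ⟨b, hb, hmax⟩ := Finset.exists_max_image A norm ⟨1, hA.one_mem⟩
    have hb1 : b ≠ 1 := by
      rintro rfl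
      apply hA1
      refine Finset.eq_singleton_iff_unique_mem.2 ⟨hb, fun x hx ↦ ?_⟩
      have := hmax x hx
      rw [norm_one] at this
      exact norm_eq_zero.1 (by omega)
    have hpb : b.parent ≠ b := fun h ↦ by
      have := norm_parent_lt hb1
      rw [h] at this
      exact lt_irrefl _ this
    have he : IsPrefixClosed (A.erase b) := by
      refine ⟨Finset.mem_erase.2 ⟨hb1.symm, hA.one_mem⟩, fun {x} hx ↦ ?_⟩
      have hxA := (Finset.mem_erase.1 hx).2
      refine Finset.mem_erase.2 ⟨fun h ↦ ?_, hA.parent_mem hxA⟩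
      have hx1 : x ≠ 1 := by
        rintro rfl
        exact hb1 h.symm
      have h1 := norm_parent_lt hx1
      have h2 := hmax x hxA
      rw [h] at h1
      omega
    rw [← Finset.insert_erase hb]
    refine h2 _ b he (Finset.notMem_erase b A)
      (Finset.mem_erase.2 ⟨hpb, hA.parent_mem hb⟩) (ih he ?_)
    rw [Finset.card_erase_of_mem hb, hn]
    rfl

/-- If an element is added to a prefix-closed set, there is one new edge. -/
lemma IsPrefixClosed.exists_edge {A : Finset (FreeGroup α)} (hA : IsPrefixClosed A)
    {b : FreeGroup α} (hb : b ∉ A) (hp : b.parent ∈ A) :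
    ∃ x s, ((x = b.parent ∧ x * of s = b) ∨ (x = b ∧ x * of s = b.parent)) ∧
      ∀ y r, y ∈ Insert.insert b A → y * of r ∈ Insert.insert b A →
        (y ∈ A ∧ y * of r ∈ A) ∨ (y = x ∧ r = s) := by
  have hb1 : b ≠ 1 := by
    rintro rfl
    exact hb hA.one_mem
  obtain ⟨⟨s, ε⟩, hs⟩ := exists_parent_mul hb1
  -- A neighbour of `b` in `A` must be the parent of `b`; otherwise `b` would be its parent and lie
  -- in `A`.
  have hadj (a : α × Bool) (h : b * FreeGroup.mk [a] ∈ A) : b.parent = b * FreeGroup.mk [a] := by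
    rcases parent_eq_or b a with h' | h'
    · exact absurd (h' ▸ hA.parent_mem h) hb
    · exact h'
  have hne (r : α) : b * of r ≠ b := fun h ↦ of_ne_one r (mul_eq_left.1 h)
  have key (y : FreeGroup α) (r : α) (hy : y ∈ Insert.insert b A)
      (hyr : y * of r ∈ Insert.insert b A) : (y ∈ A ∧ y * of r ∈ A) ∨
        (y = b ∧ b * of r = b.parent) ∨ (y = b.parent ∧ b.parent * of r = b) := by
    rcases Finset.mem_insert.1 hy with rfl | hy
    · rcases Finset.mem_insert.1 hyr with h | hyr
      · exact absurd h (hne r)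
      · exact Or.inr (Or.inl ⟨rfl, (hadj (r, true) hyr).symm⟩)
    · rcases Finset.mem_insert.1 hyr with hyr | hyr
      · subst hyr
        have h0 : y * of r * FreeGroup.mk [(r, false)] = y := by
          change y * of r * (of r)⁻¹ = y
          simp
        have h1 := hadj (r, false) (by rw [h0]; assumption)
        rw [h0] at h1
        refine Or.inr (Or.inr ⟨h1.symm, by rw [h1]⟩)
      · exact Or.inl ⟨hy, hyr⟩
  have hinv (r : α) (h : b * of r = b.parent) : b.parent * FreeGroup.mk [(r, false)] = b := by
    rw [← h]
    change b * of r * (of r)⁻¹ = b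
    simp
  cases ε with
  | true =>
    refine ⟨b.parent, s, Or.inl ⟨rfl, hs⟩, fun y r hy hyr ↦ ?_⟩
    rcases key y r hy hyr with h | ⟨rfl, h⟩ | ⟨rfl, h⟩
    · exact Or.inl h
    · have := mk_singleton_injective (mul_left_cancel ((hinv r h).trans hs.symm))
      simp at this
    · have := mk_singleton_injective (mul_left_cancel (h.trans hs.symm))
      exact Or.inr ⟨rfl, congrArg Prod.fst this⟩
  | false =>
    refine ⟨b, s, Or.inr ⟨rfl, ?_⟩, fun y r hy hyr ↦ ?_⟩
    · conv_lhs => rw [← hs]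
      change b.parent * (of s)⁻¹ * of s = _
      simp
    rcases key y r hy hyr with h | ⟨rfl, h⟩ | ⟨rfl, h⟩
    · exact Or.inl h
    · have := mk_singleton_injective (mul_left_cancel ((hinv r h).trans hs.symm))
      exact Or.inr ⟨rfl, congrArg Prod.fst this⟩
    · have := mk_singleton_injective (mul_left_cancel (h.trans hs.symm))
      simp at this

/-- The prefix-closed finite subsets. -/
abbrev PrefixClosed (α : Type) [DecidableEq α] : Type :=
  {A : Finset (FreeGroup α) // IsPrefixClosed A}

instance : Nonempty (PrefixClosed α) := ⟨⟨{1}, isPrefixClosed_singleton_one⟩⟩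

instance : IsDirectedOrder (PrefixClosed α) where
  directed A B := ⟨⟨A.1 ∪ B.1, A.2.union B.2⟩, Finset.subset_union_left, Finset.subset_union_right⟩

end FreeGroup

/-! ### The Cayley complex of `F₃ ⋊ F₂` -/

namespace F3F2

open CayleyCell CayleyComplex

/-- The homomorphism from the free group on the generators of the presentation. -/
def gen : FreeGroup (Fin 2 ⊕ Fin 3) →* F3F2 :=
  FreeGroup.lift (Sum.elim (fun i ↦ SemidirectProduct.inr (FreeGroup.of i))
    (fun j ↦ SemidirectProduct.inl (FreeGroup.of j)))

lemma gen_inl (i : Fin 2) : gen (FreeGroup.of (Sum.inl i)) =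
    SemidirectProduct.inr (FreeGroup.of i) := FreeGroup.lift_apply_of ..

lemma gen_inr (j : Fin 3) : gen (FreeGroup.of (Sum.inr j)) =
    SemidirectProduct.inl (FreeGroup.of j) := FreeGroup.lift_apply_of ..

lemma gen_map_inr (x : FreeGroup (Fin 3)) : gen (FreeGroup.map Sum.inr x) =
    SemidirectProduct.inl x := by
  have : gen.comp (FreeGroup.map Sum.inr) = SemidirectProduct.inl := by
    ext j : 1
    rw [MonoidHom.comp_apply, FreeGroup.map.of, gen_inr]
  exact DFunLike.congr_fun this x

lemma gen_mk_map_inr (w : List (Fin 3 × Bool)) :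
    gen (FreeGroup.mk (w.map fun a ↦ (Sum.inr a.1, a.2))) =
      SemidirectProduct.inl (FreeGroup.mk w) := by
  rw [← gen_map_inr, FreeGroup.map.mk]

lemma gen_of_ne_one (s : Fin 2 ⊕ Fin 3) : gen (FreeGroup.of s) ≠ 1 := by
  cases s with
  | inl i =>
    rw [gen_inl]
    exact fun h ↦ FreeGroup.of_ne_one i (congrArg SemidirectProduct.right h)
  | inr j =>
    rw [gen_inr]
    exact fun h ↦ FreeGroup.of_ne_one j (congrArg SemidirectProduct.left h)

lemma alphaAction_of (i : Fin 2) : alphaAction (FreeGroup.of i) = alphaAut i :=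
  FreeGroup.lift_apply_of ..

lemma alphaAut_of (i : Fin 2) (j : Fin 3) : alphaAut i (FreeGroup.of j) = conjBeta i j :=
  FreeGroup.lift_apply_of ..

lemma gen_relator (r : Fin 2 × Fin 3) : gen (relatorF3F2 r) = 1 := by
  rw [relatorF3F2, map_mul, map_mul, map_mul, map_inv, map_inv, gen_inl, gen_inr, gen_map_inr,
    ← alphaAut_of, ← alphaAction_of, SemidirectProduct.inl_aut]
  simp

/-- No cancellation occurs in these words, so the attaching path of a face really consists of an
α-edge, a β-edge, an α-edge traversed backwards, and a β-path. -/
lemma toWord_relator (i : Fin 2) (j : Fin 3) : (relatorF3F2 (i, j)).toWord =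
    (Sum.inl i, true) :: (Sum.inr j, true) :: (Sum.inl i, false) ::
      (FreeGroup.invRev (conjBeta i j).toWord).map fun a ↦ (Sum.inr a.1, a.2) := by
  fin_cases i <;> fin_cases j <;> rfl

/-- The element `α β` for `α` in `F₂` and `β` in `F₃`. -/
def vtx (v : FreeGroup (Fin 2)) (h : FreeGroup (Fin 3)) : F3F2 :=
  SemidirectProduct.inr v * SemidirectProduct.inl h

/-- The factor in `F₃` of an element of `F₃ ⋊ F₂`. -/
def coord (g : F3F2) : FreeGroup (Fin 3) := (alphaAction g.right)⁻¹ g.left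

@[simp] lemma right_vtx (v : FreeGroup (Fin 2)) (h : FreeGroup (Fin 3)) :
    (vtx v h).right = v := by simp [vtx]

@[simp] lemma coord_vtx (v : FreeGroup (Fin 2)) (h : FreeGroup (Fin 3)) :
    coord (vtx v h) = h := by simp [vtx, coord]

lemma vtx_coord (g : F3F2) : vtx g.right (coord g) = g := by
  ext <;> simp [vtx, coord, -map_inv]

@[simp] lemma vtx_inj {v v' : FreeGroup (Fin 2)} {h h' : FreeGroup (Fin 3)} :
    vtx v h = vtx v' h' ↔ v = v' ∧ h = h' := by
  refine ⟨fun e ↦ ⟨?_, ?_⟩, fun e ↦ by rw [e.1, e.2]⟩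
  · rw [← right_vtx v h, e, right_vtx]
  · rw [← coord_vtx v h, e, coord_vtx]

lemma vtx_mul_inl (v : FreeGroup (Fin 2)) (h x : FreeGroup (Fin 3)) :
    vtx v h * SemidirectProduct.inl x = vtx v (h * x) := by
  rw [vtx, vtx, mul_assoc, map_mul]

/-- This is the relation α_i(h) α_i = α_i h. It suggests labelling the α-edges by the element `h` at
their end, so that they run from the vertex `alphaAut i h` over `v` to the vertex `h` over the next
coset. -/
lemma vtx_mul_inr (v : FreeGroup (Fin 2)) (i : Fin 2) (h : FreeGroup (Fin 3)) :
    vtx v (alphaAut i h) * SemidirectProduct.inr (FreeGroup.of i) = vtx (v * FreeGroup.of i) h := by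
  rw [vtx, vtx, ← alphaAction_of, SemidirectProduct.inl_aut]
  simp [mul_assoc]

@[simp] lemma vtx_mul_gen_inr (v : FreeGroup (Fin 2)) (h : FreeGroup (Fin 3)) (j : Fin 3) :
    vtx v h * gen (FreeGroup.of (Sum.inr j)) = vtx v (h * FreeGroup.of j) := by
  rw [gen_inr, vtx_mul_inl]

@[simp] lemma vtx_mul_gen_inl (v : FreeGroup (Fin 2)) (h : FreeGroup (Fin 3)) (i : Fin 2) :
    vtx v (alphaAut i h) * gen (FreeGroup.of (Sum.inl i)) = vtx (v * FreeGroup.of i) h := by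
  rw [gen_inl, vtx_mul_inr]

/-- The cells of the Cayley complex. -/
abbrev Cell : Type := CayleyCell F3F2 (Fin 2 ⊕ Fin 3) (Fin 2 × Fin 3)

-- As `alphaAut i` is surjective, every α-edge and every face has the form in which its cells are
-- labelled by the coset at the end of the α-edge. Membership in regions is then a plain condition
-- on `v` and `h`.
@[elab_as_elim]
lemma cell_cases {motive : Cell → Prop} (hV : ∀ v h, motive (vert (vtx v h)))
    (hβ : ∀ v h j, motive (oneCell (vtx v h) (Sum.inr j)))
    (hα : ∀ v i h, motive (oneCell (vtx v (alphaAut i h)) (Sum.inl i)))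
    (hF : ∀ v i h j, motive (twoCell (vtx v (alphaAut i h)) (i, j))) (c : Cell) : motive c := by
  have key (g : F3F2) (i : Fin 2) : ∃ v h, g = vtx v (alphaAut i h) :=
    ⟨g.right, (alphaAut i)⁻¹ (coord g), by
      rw [← MulAut.mul_apply, mul_inv_cancel, MulAut.one_apply, vtx_coord]⟩
  cases c with
  | vert g =>
    rw [← vtx_coord g]
    exact hV _ _
  | oneCell g s =>
    cases s with
    | inl i =>
      obtain ⟨v, h, rfl⟩ := key g i
      exact hα v i h
    | inr j =>
      rw [← vtx_coord g]
      exact hβ _ _ _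
  | twoCell g r =>
    obtain ⟨i, j⟩ := r
    obtain ⟨v, h, rfl⟩ := key g i
    exact hF v i h j

/-- The full subcomplex with given vertices and given edges labelled by generators of `F₂`. -/
def region (P : FreeGroup (Fin 2) → FreeGroup (Fin 3) → Prop)
    (Q : FreeGroup (Fin 2) → Fin 2 → FreeGroup (Fin 3) → Prop) : Set Cell := fun c ↦
  match c with
  | vert g => P g.right (coord g)
  | oneCell g (Sum.inr j) => P g.right (coord g) ∧ P g.right (coord g * FreeGroup.of j)
  | oneCell g (Sum.inl i) => Q g.right i ((alphaAut i)⁻¹ (coord g))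
  | twoCell g (i, j) => Q g.right i ((alphaAut i)⁻¹ (coord g)) ∧
      Q g.right i ((alphaAut i)⁻¹ (coord g) * FreeGroup.of j)

section region

variable {P P' : FreeGroup (Fin 2) → FreeGroup (Fin 3) → Prop}
  {Q Q' : FreeGroup (Fin 2) → Fin 2 → FreeGroup (Fin 3) → Prop}
  {v : FreeGroup (Fin 2)} {h : FreeGroup (Fin 3)} {i : Fin 2} {j : Fin 3}

@[simp] lemma vert_mem_region : vert (vtx v h) ∈ region P Q ↔ P v h := by
  change P _ _ ↔ _
  simp

@[simp] lemma oneCell_inr_mem_region : oneCell (vtx v h) (Sum.inr j) ∈ region P Q ↔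
    P v h ∧ P v (h * FreeGroup.of j) := by
  change P _ _ ∧ P _ _ ↔ _
  simp

@[simp] lemma oneCell_inl_mem_region : oneCell (vtx v (alphaAut i h)) (Sum.inl i) ∈ region P Q ↔
    Q v i h := by
  change Q _ _ _ ↔ _
  simp

@[simp] lemma twoCell_mem_region : twoCell (vtx v (alphaAut i h)) (i, j) ∈ region P Q ↔
    Q v i h ∧ Q v i (h * FreeGroup.of j) := by
  change Q _ _ _ ∧ Q _ _ _ ↔ _
  simp

lemma region_mono (hP : ∀ v h, P v h → P' v h) (hQ : ∀ v i h, Q v i h → Q' v i h) :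
    region P Q ⊆ region P' Q' := by
  intro c
  induction c using cell_cases with
  | hV v h => simpa using hP v h
  | hβ v h j => simpa using fun h1 h2 ↦ ⟨hP _ _ h1, hP _ _ h2⟩
  | hα v i h => simpa using hQ v i h
  | hF v i h j => simpa using fun h1 h2 ↦ ⟨hQ _ _ _ h1, hQ _ _ _ h2⟩

lemma iUnion_region {J : Type} [Preorder J] [IsDirectedOrder J] [Nonempty J]
    {P : J → FreeGroup (Fin 2) → FreeGroup (Fin 3) → Prop}
    {Q : J → FreeGroup (Fin 2) → Fin 2 → FreeGroup (Fin 3) → Prop}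
    (hP : ∀ a b, a ≤ b → ∀ v h, P a v h → P b v h)
    (hQ : ∀ a b, a ≤ b → ∀ v i h, Q a v i h → Q b v i h) :
    ⋃ a, region (P a) (Q a) = region (fun v h ↦ ∃ a, P a v h) (fun v i h ↦ ∃ a, Q a v i h) := by
  ext c
  rw [Set.mem_iUnion]
  induction c using cell_cases with
  | hV v h => simp
  | hβ v h j =>
    simp only [oneCell_inr_mem_region]
    refine ⟨fun ⟨a, h1, h2⟩ ↦ ⟨⟨a, h1⟩, a, h2⟩, fun ⟨⟨a, h1⟩, b, h2⟩ ↦ ?_⟩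
    obtain ⟨c, hac, hbc⟩ := exists_ge_ge a b
    exact ⟨c, hP _ _ hac _ _ h1, hP _ _ hbc _ _ h2⟩
  | hα v i h => simp
  | hF v i h j =>
    simp only [twoCell_mem_region]
    refine ⟨fun ⟨a, h1, h2⟩ ↦ ⟨⟨a, h1⟩, a, h2⟩, fun ⟨⟨a, h1⟩, b, h2⟩ ↦ ?_⟩
    obtain ⟨c, hac, hbc⟩ := exists_ge_ge a b
    exact ⟨c, hQ _ _ hac _ _ _ h1, hQ _ _ hbc _ _ _ h2⟩

end region

/-- The word of a path in `F₃` at a vertex. -/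
abbrev fiberTrace (v : FreeGroup (Fin 2)) (k : FreeGroup (Fin 3)) (w : List (Fin 3 × Bool)) :
    Set Cell :=
  trace (Fin 2 × Fin 3) gen (vtx v k) (w.map fun a ↦ (Sum.inr a.1, a.2))

lemma vtx_mul_gen_letter (v : FreeGroup (Fin 2)) (k : FreeGroup (Fin 3)) (a : Fin 3 × Bool) :
    vtx v k * gen (FreeGroup.mk [(Sum.inr a.1, a.2)]) = vtx v (k * FreeGroup.mk [a]) := by
  rw [← vtx_mul_inl, ← gen_mk_map_inr]
  rfl

lemma letterTrace_subset_region (v : FreeGroup (Fin 2)) (k : FreeGroup (Fin 3)) (a : Fin 3 × Bool) :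
    letterTrace (Fin 2 × Fin 3) gen (vtx v k) (Sum.inr a.1, a.2) ⊆
      region (fun v' _ ↦ v' = v) (fun _ _ _ ↦ False) := by
  obtain ⟨j, _ | _⟩ := a
  · have := vtx_mul_gen_letter v k (j, false)
    rintro c (rfl | rfl | rfl) <;> simp_all
  · rintro c (rfl | rfl | rfl) <;> simp

lemma fiberTrace_subset (v : FreeGroup (Fin 2)) (k : FreeGroup (Fin 3)) (w : List (Fin 3 × Bool)) :
    fiberTrace v k w ⊆ region (fun v' _ ↦ v' = v) (fun _ _ _ ↦ False) := by
  induction w generalizing k with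
  | nil =>
    rintro c rfl
    simp
  | cons a w ih =>
    refine Set.union_subset (letterTrace_subset_region v k a) ?_
    rw [vtx_mul_gen_letter]
    exact ih _

lemma exists_prefix_of_vert_mem {v v' : FreeGroup (Fin 2)} {k k' : FreeGroup (Fin 3)}
    {w : List (Fin 3 × Bool)} (h : vert (vtx v' k') ∈ fiberTrace v k w) :
    ∃ p, p <+: w ∧ k' = k * FreeGroup.mk p := by
  induction w generalizing k with
  | nil =>
    obtain ⟨-, rfl⟩ : v' = v ∧ k' = k := by simpa [fiberTrace, trace] using h
    exact ⟨[], List.nil_prefix, by simp [← FreeGroup.one_eq_mk]⟩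
  | cons a w ih =>
    have hk : k' = k ∨ vert (vtx v' k') ∈ fiberTrace v (k * FreeGroup.mk [a]) w := by
      rw [fiberTrace, List.map_cons, trace, vtx_mul_gen_letter] at h
      refine h.elim (fun h ↦ ?_) Or.inr
      have h1 := vtx_mul_gen_letter v k a
      obtain ⟨j, _ | _⟩ := a
      · rcases h with h | h | h
        · left
          simp_all
        · right
          rw [h, h1]
          exact vert_mem_trace _ _
        · cases h
      · rcases h with h | h | h
        · left
          simp_all
        · right
          rw [h]
          rw [vtx_mul_gen_inr]
          exact vert_mem_trace _ _
        · cases h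
    rcases hk with rfl | hk
    · exact ⟨[], List.nil_prefix, by simp [← FreeGroup.one_eq_mk]⟩
    · obtain ⟨p, ⟨q, rfl⟩, hp⟩ := ih hk
      refine ⟨a :: p, ⟨q, rfl⟩, ?_⟩
      rw [hp, mul_assoc, FreeGroup.mul_mk]
      rfl

lemma vert_end_mem_fiberTrace (v : FreeGroup (Fin 2)) (k : FreeGroup (Fin 3))
    (w : List (Fin 3 × Bool)) : vert (vtx v (k * FreeGroup.mk w)) ∈ fiberTrace v k w := by
  induction w generalizing k with
  | nil => simp [← FreeGroup.one_eq_mk, fiberTrace, trace]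
  | cons a w ih =>
    right
    rw [vtx_mul_gen_letter]
    have := ih (k * FreeGroup.mk [a])
    rwa [mul_assoc, FreeGroup.mul_mk] at this

/-- A reduced word traces a path without backtracking in the Cayley tree of F₃. A return to an
earlier vertex would make a nonempty reduced subword trivial. -/
lemma isArc_fiber {w : List (Fin 3 × Bool)} (hw : FreeGroup.IsReduced w)
    (v : FreeGroup (Fin 2)) (k : FreeGroup (Fin 3)) :
    IsArc (Fin 2 × Fin 3) gen (vtx v k) (w.map fun a ↦ (Sum.inr a.1, a.2)) := by
  induction w generalizing k with
  | nil => exact trivial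
  | cons a w ih =>
    rw [List.map_cons, IsArc, vtx_mul_gen_letter]
    refine ⟨?_, ih (hw.infix (List.suffix_cons a w).isInfix) _⟩
    have hn : vert (vtx v k) ∉ fiberTrace v (k * FreeGroup.mk [a]) w := fun h ↦ by
      obtain ⟨p, hp, h⟩ := exists_prefix_of_vert_mem h
      rw [mul_assoc, FreeGroup.mul_mk, left_eq_mul] at h
      have h1 : FreeGroup.IsReduced (a :: p) :=
        hw.infix ((List.prefix_cons_inj a).2 hp).isInfix
      have h2 := congrArg FreeGroup.toWord h
      rw [FreeGroup.toWord_mk, FreeGroup.toWord_one, List.singleton_append, h1.reduce_eq] at h2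
      cases h2
    have hs := isSubcomplex_trace (φ := gen) (rel := relatorF3F2) (vtx v (k * FreeGroup.mk [a]))
      (w.map fun a ↦ (Sum.inr a.1, a.2))
    have hv := vtx_mul_gen_letter v k a
    refine Set.Subset.antisymm ?_ ?_
    · rintro c ⟨h1, h2⟩
      obtain ⟨j, _ | _⟩ := a
      · rcases h1 with rfl | rfl | rfl
        · exact absurd h2 hn
        · rw [hv]
          rfl
        · refine absurd (hs.right_mem h2) ?_
          rw [hv, vtx_mul_gen_inr]
          convert hn using 4
          rw [mul_assoc]
          change k * ((FreeGroup.of j)⁻¹ * _) = k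
          simp
      · rcases h1 with rfl | rfl | rfl
        · exact absurd h2 hn
        · rw [vtx_mul_gen_inr]
          rfl
        · exact absurd (hs.left_mem h2) hn
    · rintro c rfl
      refine ⟨?_, vert_mem_trace _ _⟩
      rw [← hv]
      obtain ⟨j, _ | _⟩ := a <;> exact Or.inr (Or.inl rfl)

end F3F2

/-! ### Faces as discs between neighbouring trees -/

namespace F3F2

open CayleyCell CayleyComplex

/-- The closed edge with label `α_{i+1}` that starts at the given vertex. -/
def alphaEdge (v : FreeGroup (Fin 2)) (i : Fin 2) (h : FreeGroup (Fin 3)) : Set Cell :=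
  letterTrace (Fin 2 × Fin 3) gen (vtx v (alphaAut i h)) (Sum.inl i, true)

/-- The closed edge with label `β_{j+1}` that starts at the given vertex. -/
def betaEdge (v : FreeGroup (Fin 2)) (h : FreeGroup (Fin 3)) (j : Fin 3) : Set Cell :=
  letterTrace (Fin 2 × Fin 3) gen (vtx v h) (Sum.inr j, true)

/-- The part of the boundary of a face that spells the inverse of the image of `β_{j+1}`. -/
def imageTrace (v : FreeGroup (Fin 2)) (i : Fin 2) (h : FreeGroup (Fin 3)) (j : Fin 3) : Set Cell :=
  fiberTrace v (alphaAut i (h * FreeGroup.of j)) (FreeGroup.invRev (conjBeta i j).toWord)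

section mem

variable {v v' : FreeGroup (Fin 2)} {h h' : FreeGroup (Fin 3)} {i i' : Fin 2} {j j' : Fin 3}

@[simp] lemma alpha_label_eq : oneCell (vtx v (alphaAut i h)) (Sum.inl i) =
    (oneCell (vtx v' (alphaAut i' h')) (Sum.inl i') : Cell) ↔ v = v' ∧ i = i' ∧ h = h' := by
  constructor
  · intro e
    obtain ⟨⟨e1, e2⟩, rfl⟩ := by simpa using e
    exact ⟨e1, rfl, (alphaAut i).injective e2⟩
  · rintro ⟨rfl, rfl, rfl⟩
    rfl

@[simp] lemma face_label_eq : twoCell (vtx v (alphaAut i h)) (i, j) =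
    (twoCell (vtx v' (alphaAut i' h')) (i', j') : Cell) ↔ v = v' ∧ i = i' ∧ h = h' ∧ j = j' := by
  constructor
  · intro e
    obtain ⟨⟨e1, e2⟩, rfl, rfl⟩ := by simpa using e
    exact ⟨e1, rfl, (alphaAut i).injective e2, rfl⟩
  · rintro ⟨rfl, rfl, rfl, rfl⟩
    rfl

lemma alphaEdge_eq : alphaEdge v i h = {vert (vtx v (alphaAut i h)),
    vert (vtx (v * FreeGroup.of i) h), oneCell (vtx v (alphaAut i h)) (Sum.inl i)} := by
  rw [alphaEdge, letterTrace, vtx_mul_gen_inl]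

lemma betaEdge_eq : betaEdge v h j = {vert (vtx v h),
    vert (vtx v (h * FreeGroup.of j)), oneCell (vtx v h) (Sum.inr j)} := by
  rw [betaEdge, letterTrace, vtx_mul_gen_inr]

@[simp] lemma vert_mem_alphaEdge : vert (vtx v' h') ∈ alphaEdge v i h ↔
    v' = v ∧ h' = alphaAut i h ∨ v' = v * FreeGroup.of i ∧ h' = h := by
  rw [alphaEdge_eq]
  simp

@[simp] lemma beta_notMem_alphaEdge : oneCell (vtx v' h') (Sum.inr j') ∉ alphaEdge v i h := by
  rw [alphaEdge_eq]
  simp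

@[simp] lemma alpha_mem_alphaEdge : oneCell (vtx v' (alphaAut i' h')) (Sum.inl i') ∈
    alphaEdge v i h ↔ v' = v ∧ i' = i ∧ h' = h := by
  rw [alphaEdge_eq, Set.mem_insert_iff, Set.mem_insert_iff, Set.mem_singleton_iff, alpha_label_eq]
  simp

@[simp] lemma twoCell_notMem_alphaEdge {g : F3F2} {r : Fin 2 × Fin 3} :
    twoCell g r ∉ alphaEdge v i h := by
  rw [alphaEdge_eq]
  simp

@[simp] lemma vert_mem_betaEdge : vert (vtx v' h') ∈ betaEdge v h j ↔
    v' = v ∧ (h' = h ∨ h' = h * FreeGroup.of j) := by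
  rw [betaEdge_eq]
  simp [← and_or_left]

@[simp] lemma beta_mem_betaEdge : oneCell (vtx v' h') (Sum.inr j') ∈ betaEdge v h j ↔
    v' = v ∧ h' = h ∧ j' = j := by
  rw [betaEdge_eq]
  simp [and_assoc]

@[simp] lemma alpha_notMem_betaEdge {g : F3F2} : oneCell g (Sum.inl i) ∉ betaEdge v h j := by
  rw [betaEdge_eq]
  simp

@[simp] lemma twoCell_notMem_betaEdge {g : F3F2} {r : Fin 2 × Fin 3} :
    twoCell g r ∉ betaEdge v h j := by
  rw [betaEdge_eq]
  simp

lemma eq_of_vert_mem_imageTrace (h1 : vert (vtx v' h') ∈ imageTrace v i h j) : v' = v := by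
  simpa using fiberTrace_subset _ _ _ h1

lemma eq_of_oneCell_mem_imageTrace (h1 : oneCell (vtx v' h') (Sum.inr j') ∈ imageTrace v i h j) :
    v' = v := by
  simpa using fiberTrace_subset _ _ _ h1

lemma alpha_notMem_imageTrace :
    oneCell (vtx v' (alphaAut i' h')) (Sum.inl i') ∉ imageTrace v i h j := fun h1 ↦ by
  simpa using fiberTrace_subset _ _ _ h1

lemma face_notMem_imageTrace :
    twoCell (vtx v' (alphaAut i' h')) (i', j') ∉ imageTrace v i h j := fun h1 ↦ by
  simpa using fiberTrace_subset _ _ _ h1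

lemma start_mem_imageTrace :
    vert (vtx v (alphaAut i (h * FreeGroup.of j))) ∈ imageTrace v i h j := vert_mem_trace _ _

/-- The path starts at α_i(h β_j) = α_i(h) α_i(β_j) and reads the inverse of the last factor. -/
lemma end_mem_imageTrace : vert (vtx v (alphaAut i h)) ∈ imageTrace v i h j := by
  have := vert_end_mem_fiberTrace v (alphaAut i (h * FreeGroup.of j))
    (FreeGroup.invRev (conjBeta i j).toWord)
  rwa [← FreeGroup.inv_mk, FreeGroup.mk_toWord, map_mul, alphaAut_of, mul_inv_cancel_right,
    ← alphaAut_of, ← map_mul, alphaAut_of] at this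

lemma isArc_image (v : FreeGroup (Fin 2)) (i : Fin 2) (h : FreeGroup (Fin 3)) (j : Fin 3) :
    IsArc (Fin 2 × Fin 3) gen (vtx v (alphaAut i (h * FreeGroup.of j)))
      ((FreeGroup.invRev (conjBeta i j).toWord).map fun a ↦ (Sum.inr a.1, a.2)) := by
  refine isArc_fiber ?_ _ _
  rw [← FreeGroup.toWord_inv]
  exact FreeGroup.isReduced_toWord

lemma vtx_mul_gen_inl_inv (v : FreeGroup (Fin 2)) (h : FreeGroup (Fin 3)) (i : Fin 2) :
    vtx (v * FreeGroup.of i) h * gen (FreeGroup.mk [(Sum.inl i, false)]) =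
      vtx v (alphaAut i h) := by
  rw [← vtx_mul_gen_inl, mul_assoc, ← map_mul]
  change _ * gen (FreeGroup.of (Sum.inl i) * (FreeGroup.of (Sum.inl i))⁻¹) = _
  simp

lemma letterTrace_alpha_inv : letterTrace (Fin 2 × Fin 3) gen (vtx (v * FreeGroup.of i) h)
    (Sum.inl i, false) = alphaEdge v i h := by
  rw [letterTrace, vtx_mul_gen_inl_inv, alphaEdge_eq, Set.insert_comm]

/-- The boundary of a face. -/
lemma trace_relator (v : FreeGroup (Fin 2)) (i : Fin 2) (h : FreeGroup (Fin 3)) (j : Fin 3) :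
    trace (Fin 2 × Fin 3) gen (vtx v (alphaAut i h)) (relatorF3F2 (i, j)).toWord =
      alphaEdge v i h ∪ (betaEdge (v * FreeGroup.of i) h j ∪
        (alphaEdge v i (h * FreeGroup.of j) ∪ imageTrace v i h j)) := by
  rw [toWord_relator, trace, trace, trace]
  change _ ∪ (letterTrace _ _ (_ * gen (FreeGroup.of (Sum.inl i))) _ ∪
    (letterTrace _ _ (_ * gen (FreeGroup.of (Sum.inl i)) * gen (FreeGroup.of (Sum.inr j))) _ ∪
      trace _ _ (_ * gen (FreeGroup.of (Sum.inl i)) * gen (FreeGroup.of (Sum.inr j)) * _) _)) = _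
  rw [vtx_mul_gen_inl, vtx_mul_gen_inr, letterTrace_alpha_inv, vtx_mul_gen_inl_inv]
  rfl

/-- The boundaries of the faces are simple closed edge paths. -/
lemma isCircle_relator (v : FreeGroup (Fin 2)) (i : Fin 2) (h : FreeGroup (Fin 3)) (j : Fin 3) :
    IsCircle (Fin 2 × Fin 3) gen (vtx v (alphaAut i h)) (relatorF3F2 (i, j)).toWord := by
  rw [toWord_relator, IsCircle, IsArc, IsArc, trace, trace]
  change _ ∧ letterTrace _ _ _ _ ∩
    (letterTrace _ _ (_ * gen (FreeGroup.of (Sum.inl i))) _ ∪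
    (letterTrace _ _ (_ * gen (FreeGroup.of (Sum.inl i)) * gen (FreeGroup.of (Sum.inr j))) _ ∪
      trace _ _ (_ * gen (FreeGroup.of (Sum.inl i)) * gen (FreeGroup.of (Sum.inr j)) * _) _)) =
      {_, vert (_ * gen (FreeGroup.of (Sum.inl i)))} ∧
    letterTrace _ _ (_ * gen (FreeGroup.of (Sum.inl i))) _ ∩
    (letterTrace _ _ (_ * gen (FreeGroup.of (Sum.inl i)) * gen (FreeGroup.of (Sum.inr j))) _ ∪
      trace _ _ (_ * gen (FreeGroup.of (Sum.inl i)) * gen (FreeGroup.of (Sum.inr j)) * _) _) =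
      {vert (_ * gen (FreeGroup.of (Sum.inl i)) * gen (FreeGroup.of (Sum.inr j)))} ∧
    letterTrace _ _ (_ * gen (FreeGroup.of (Sum.inl i)) * gen (FreeGroup.of (Sum.inr j))) _ ∩
      trace _ _ (_ * gen (FreeGroup.of (Sum.inl i)) * gen (FreeGroup.of (Sum.inr j)) * _) _ =
      {vert (_ * gen (FreeGroup.of (Sum.inl i)) * gen (FreeGroup.of (Sum.inr j)) * _)} ∧
    IsArc _ _ (_ * gen (FreeGroup.of (Sum.inl i)) * gen (FreeGroup.of (Sum.inr j)) * _) _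
  rw [vtx_mul_gen_inl, vtx_mul_gen_inr, letterTrace_alpha_inv, vtx_mul_gen_inl_inv]
  change _ ∧ alphaEdge v i h ∩ (betaEdge (v * FreeGroup.of i) h j ∪
        (alphaEdge v i (h * FreeGroup.of j) ∪ imageTrace v i h j)) = _ ∧
    betaEdge (v * FreeGroup.of i) h j ∩
      (alphaEdge v i (h * FreeGroup.of j) ∪ imageTrace v i h j) = _ ∧
    alphaEdge v i (h * FreeGroup.of j) ∩ imageTrace v i h j = _ ∧ _
  -- The β-edge and the image path lie over the different cosets v and vα_i; the two α-edges are
  -- disjoint because h ≠ h β_j and `alphaAut i` is injective. So consecutive sides of the face meet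
  -- only in the corners.
  have hv : v * FreeGroup.of i ≠ v := fun e ↦ FreeGroup.of_ne_one i (mul_eq_left.1 e)
  have hh : h * FreeGroup.of j ≠ h := fun e ↦ FreeGroup.of_ne_one j (mul_eq_left.1 e)
  have hT : vert (vtx v (alphaAut i h)) ∈ imageTrace v i h j := end_mem_imageTrace
  have hT' : vert (vtx v (alphaAut i (h * FreeGroup.of j))) ∈ imageTrace v i h j :=
    start_mem_imageTrace
  have hTv {v' h'} (h1 : vert (vtx v' h') ∈ imageTrace v i h j) : v' = v :=
    eq_of_vert_mem_imageTrace h1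
  have hTe {v' h' j'} (h1 : oneCell (vtx v' h') (Sum.inr j') ∈ imageTrace v i h j) : v' = v :=
    eq_of_oneCell_mem_imageTrace h1
  have hTa {v' i' h'} : oneCell (vtx v' (alphaAut i' h')) (Sum.inl i') ∉ imageTrace v i h j :=
    alpha_notMem_imageTrace
  refine ⟨List.cons_ne_nil _ _, ?_, ?_, ?_, isArc_image v i h j⟩
  · ext c
    induction c using cell_cases <;> simp [-map_mul] <;> grind [-map_mul]
  · ext c
    induction c using cell_cases <;> simp [-map_mul] <;> grind [-map_mul]
  · ext c
    induction c using cell_cases <;> simp [-map_mul] <;> grind [-map_mul]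

end mem

/-- Subcomplexes with realization an extensor. -/
structure IsFilled (A : Set Cell) : Prop where
  isSubcomplex : IsSubcomplex gen relatorF3F2 A
  isExtensor : IsExtensor (realize gen_relator A)

namespace IsFilled

variable {A B : Set Cell}

lemma union (hA : IsFilled A) (hB : IsFilled B) (hAB : IsFilled (A ∩ B)) : IsFilled (A ∪ B) :=
  ⟨hA.1.union hB.1, isExtensor_realize_union hA.1 hB.1 hA.2 hB.2 hAB.2⟩

lemma union_of_eq {C D : Set Cell} (hA : IsFilled A) (hB : IsFilled B) (hC : IsFilled C)
    (h : A ∩ B = C) (h' : A ∪ B = D) : IsFilled D := by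
  subst h h'
  exact hA.union hB hC

lemma vert (g : F3F2) : IsFilled {CayleyCell.vert g} :=
  ⟨isSubcomplex_trace g [], isExtensor_realize_vert g⟩

lemma iUnion {J : Type} [Nonempty J] {A : J → Set Cell} (hd : Directed (· ⊆ ·) A)
    (hA : ∀ j, IsFilled (A j)) : IsFilled (⋃ j, A j) :=
  ⟨IsSubcomplex.iUnion fun j ↦ (hA j).1,
    isExtensor_realize_iUnion gen_of_ne_one hd (fun j ↦ (hA j).1) fun j ↦ (hA j).2⟩

lemma alphaEdge (v : FreeGroup (Fin 2)) (i : Fin 2) (h : FreeGroup (Fin 3)) :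
    IsFilled (F3F2.alphaEdge v i h) :=
  ⟨isSubcomplex_letterTrace _ _, isExtensor_letterTrace gen_of_ne_one _ _⟩

lemma betaEdge (v : FreeGroup (Fin 2)) (h : FreeGroup (Fin 3)) (j : Fin 3) :
    IsFilled (F3F2.betaEdge v h j) :=
  ⟨isSubcomplex_letterTrace _ _, isExtensor_letterTrace gen_of_ne_one _ _⟩

lemma imageTrace (v : FreeGroup (Fin 2)) (i : Fin 2) (h : FreeGroup (Fin 3)) (j : Fin 3) :
    IsFilled (F3F2.imageTrace v i h j) :=
  ⟨isSubcomplex_trace _ _, isExtensor_trace gen_of_ne_one (isArc_image v i h j)⟩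

lemma face (v : FreeGroup (Fin 2)) (i : Fin 2) (h : FreeGroup (Fin 3)) (j : Fin 3) :
    IsFilled (insert (twoCell (vtx v (alphaAut i h)) (i, j))
      (F3F2.alphaEdge v i h ∪ (F3F2.betaEdge (v * FreeGroup.of i) h j ∪
        (F3F2.alphaEdge v i (h * FreeGroup.of j) ∪ F3F2.imageTrace v i h j)))) := by
  rw [← trace_relator]
  exact ⟨isSubcomplex_insert_face _ _, isExtensor_face gen_of_ne_one (isCircle_relator v i h j)⟩

lemma iUnion_region {J : Type} [Preorder J] [IsDirectedOrder J] [Nonempty J]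
    {P : J → FreeGroup (Fin 2) → FreeGroup (Fin 3) → Prop}
    {Q : J → FreeGroup (Fin 2) → Fin 2 → FreeGroup (Fin 3) → Prop}
    (hP : ∀ a b, a ≤ b → ∀ v h, P a v h → P b v h)
    (hQ : ∀ a b, a ≤ b → ∀ v i h, Q a v i h → Q b v i h)
    (h : ∀ a, IsFilled (region (P a) (Q a))) :
    IsFilled (region (fun v h ↦ ∃ a, P a v h) (fun v i h ↦ ∃ a, Q a v i h)) := by
  rw [← F3F2.iUnion_region hP hQ]
  refine iUnion (fun a b ↦ ?_) h
  obtain ⟨c, ha, hb⟩ := exists_ge_ge a b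
  exact ⟨c, region_mono (hP _ _ ha) (hQ _ _ ha), region_mono (hP _ _ hb) (hQ _ _ hb)⟩

end IsFilled

/-! ### Filling the trees, the strips and the whole complex -/

open FreeGroup (IsPrefixClosed PrefixClosed)

/-- A finite subtree grows by one edge at a time, and the new edge meets the old subtree only in the
parent of the new vertex. -/
lemma isFilled_fiber_finite (v : FreeGroup (Fin 2)) {A : Finset (FreeGroup (Fin 3))}
    (hA : IsPrefixClosed A) :
    IsFilled (region (fun v' h ↦ v' = v ∧ h ∈ A) (fun _ _ _ ↦ False)) := by
  refine IsPrefixClosed.induction (P := fun A ↦ IsFilled (region (fun v' h ↦ v' = v ∧ h ∈ A) (fun _ _ _ ↦ False))) ?_ ?_ hA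
  · convert IsFilled.vert (vtx v 1) using 1
    ext c
    induction c using cell_cases <;> simp
    rintro - rfl
    simp
  · intro A b hA hb hp ih
    obtain ⟨x, s, hx, he⟩ := hA.exists_edge hb hp
    refine ih.union_of_eq (IsFilled.betaEdge v x s) (IsFilled.vert (vtx v b.parent)) ?_ ?_
    · ext c
      induction c using cell_cases <;> simp <;> grind
    · ext c
      induction c using cell_cases <;> simp <;> grind

/-- The trees of the cosets of `F₃`. -/
lemma isFilled_fiber (v : FreeGroup (Fin 2)) :
    IsFilled (region (fun v' _ ↦ v' = v) (fun _ _ _ ↦ False)) := by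
  have := IsFilled.iUnion_region (J := PrefixClosed (Fin 3)) (P := fun A v' h ↦ v' = v ∧ h ∈ A.1)
    (Q := fun _ _ _ _ ↦ False) (fun _ _ h _ _ h' ↦ ⟨h'.1, h h'.2⟩) (fun _ _ _ _ _ _ h ↦ h)
    (fun A ↦ isFilled_fiber_finite v A.2)
  convert this using 4 with v' h
  · refine ⟨fun e ↦ ?_, fun ⟨_, e, _⟩ ↦ e⟩
    obtain ⟨A, hA, hm⟩ := FreeGroup.exists_isPrefixClosed_mem h
    exact ⟨⟨A, hA⟩, e, hm⟩
  · simp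

section strip

variable {P : FreeGroup (Fin 2) → FreeGroup (Fin 3) → Prop}
  {Q : FreeGroup (Fin 2) → Fin 2 → FreeGroup (Fin 3) → Prop}
  {v : FreeGroup (Fin 2)} {i : Fin 2}

/-- This builds the mapping cylinder over a finite subtree `B` of the new tree. It starts with the
α-edge that ends at 1, and each new vertex of `B` brings one face, glued along an arc: the α-edge at
the parent and the image path. The hypothesis `hv` ensures that all image paths are already present,
and `hn` that nothing lies over the new coset. -/
lemma isFilled_strip_finite (hL : IsFilled (region P Q)) (hv : ∀ h, P v h)
    (hn : ∀ h, ¬ P (v * FreeGroup.of i) h) {B : Finset (FreeGroup (Fin 3))}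
    (hB : IsPrefixClosed B) :
    IsFilled (region (fun v' h ↦ P v' h ∨ v' = v * FreeGroup.of i ∧ h ∈ B)
      (fun v' i' h ↦ Q v' i' h ∨ v' = v ∧ i' = i ∧ h ∈ B)) := by
  -- An α_i-edge at `v` that is already present would have its end over the new coset.
  have hQ (h) : ¬ Q v i h := fun hq ↦ by
    have := hL.1.right_mem (oneCell_inl_mem_region.2 hq)
    rw [vtx_mul_gen_inl, vert_mem_region] at this
    exact hn _ this
  have hne : v * FreeGroup.of i ≠ v := fun e ↦ FreeGroup.of_ne_one i (mul_eq_left.1 e)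
  have hone (h : FreeGroup (Fin 3)) (j : Fin 3) : h * FreeGroup.of j ≠ h :=
    fun e ↦ FreeGroup.of_ne_one j (mul_eq_left.1 e)
  refine IsPrefixClosed.induction (P := fun B ↦ IsFilled (region
      (fun v' h ↦ P v' h ∨ v' = v * FreeGroup.of i ∧ h ∈ B)
      (fun v' i' h ↦ Q v' i' h ∨ v' = v ∧ i' = i ∧ h ∈ B))) ?_ ?_ hB
  · refine hL.union_of_eq (IsFilled.alphaEdge v i 1) (IsFilled.vert (vtx v (alphaAut i 1))) ?_ ?_
    · ext c
      induction c using cell_cases <;> simp [-map_mul, -map_one] <;> grind [-map_mul]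
    · ext c
      induction c using cell_cases <;> simp [-map_mul, -map_one] <;> grind [-map_mul]
  · intro B b hB hb hp ih
    obtain ⟨x, s, hx, he⟩ := hB.exists_edge hb hp
    have hTv {v' h'} (h1 : vert (vtx v' h') ∈ imageTrace v i x s) : v' = v :=
      eq_of_vert_mem_imageTrace h1
    have hTe {v' h' j'} (h1 : oneCell (vtx v' h') (Sum.inr j') ∈ imageTrace v i x s) : v' = v :=
      eq_of_oneCell_mem_imageTrace h1
    have hTa {v' i' h'} : oneCell (vtx v' (alphaAut i' h')) (Sum.inl i') ∉ imageTrace v i x s :=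
      alpha_notMem_imageTrace
    have hTf {v' i' h' j'} : twoCell (vtx v' (alphaAut i' h')) (i', j') ∉ imageTrace v i x s :=
      face_notMem_imageTrace
    have hT : vert (vtx v (alphaAut i x)) ∈ imageTrace v i x s := end_mem_imageTrace
    have hT' : vert (vtx v (alphaAut i (x * FreeGroup.of s))) ∈ imageTrace v i x s :=
      start_mem_imageTrace
    -- The α-edge at the parent meets the image path in a single vertex, which is one of the two
    -- ends of that path, depending on the direction of the edge between `b` and its parent.
    have hC : IsFilled (alphaEdge v i b.parent ∪ imageTrace v i x s) := by
      refine (IsFilled.alphaEdge _ _ _).union_of_eq (IsFilled.imageTrace v i x s)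
        (IsFilled.vert (vtx v (alphaAut i b.parent))) ?_ rfl
      ext c
      induction c using cell_cases <;> simp [-map_mul] <;> grind [-map_mul]
    refine ih.union_of_eq (IsFilled.face v i x s) hC ?_ ?_
    · ext c
      induction c using cell_cases <;> simp only [Set.mem_inter_iff, Set.mem_union,
        Set.mem_insert_iff, face_label_eq] <;> simp [-map_mul] <;> grind [-map_mul]
    · ext c
      induction c using cell_cases <;> simp only [Set.mem_union, Set.mem_insert_iff,
        face_label_eq] <;> simp [-map_mul] <;> grind [-map_mul]

/-- A full tree can be joined along all edges to a full tree. -/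
lemma isFilled_strip (hL : IsFilled (region P Q)) (hv : ∀ h, P v h)
    (hn : ∀ h, ¬ P (v * FreeGroup.of i) h) :
    IsFilled (region (fun v' h ↦ P v' h ∨ v' = v * FreeGroup.of i)
      (fun v' i' h ↦ Q v' i' h ∨ v' = v ∧ i' = i)) := by
  have := IsFilled.iUnion_region (J := PrefixClosed (Fin 3))
    (P := fun B v' h ↦ P v' h ∨ v' = v * FreeGroup.of i ∧ h ∈ B.1)
    (Q := fun B v' i' h ↦ Q v' i' h ∨ v' = v ∧ i' = i ∧ h ∈ B.1)
    (fun _ _ h _ _ h' ↦ h'.imp_right fun h' ↦ ⟨h'.1, h h'.2⟩)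
    (fun _ _ h _ _ _ h' ↦ h'.imp_right fun h' ↦ ⟨h'.1, h'.2.1, h h'.2.2⟩)
    (fun B ↦ isFilled_strip_finite hL hv hn B.2)
  convert this using 4 with v' h v' i'
  · obtain ⟨A, hA, hm⟩ := FreeGroup.exists_isPrefixClosed_mem h
    exact ⟨fun e ↦ ⟨⟨A, hA⟩, e.imp_right fun e ↦ ⟨e, hm⟩⟩,
      fun ⟨_, e⟩ ↦ e.imp_right fun e ↦ e.1⟩
  · ext h
    obtain ⟨A, hA, hm⟩ := FreeGroup.exists_isPrefixClosed_mem h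
    exact ⟨fun e ↦ ⟨⟨A, hA⟩, e.imp_right fun e ↦ ⟨e.1, e.2, hm⟩⟩,
      fun ⟨_, e⟩ ↦ e.imp_right fun e ↦ ⟨e.1, e.2.1⟩⟩

end strip

/-- Cosets are added along the Cayley tree of F₂. The new strip is a mapping cylinder whose target
tree is the old or the new one, depending on the direction of the edge between `u` and its parent.
-/
lemma isFilled_cosets {W : Finset (FreeGroup (Fin 2))} (hW : IsPrefixClosed W) :
    IsFilled (region (fun v _ ↦ v ∈ W) (fun v i _ ↦ v ∈ W ∧ v * FreeGroup.of i ∈ W)) := by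
  have hone (h : FreeGroup (Fin 2)) (j : Fin 2) : h * FreeGroup.of j ≠ h :=
    fun e ↦ FreeGroup.of_ne_one j (mul_eq_left.1 e)
  refine IsPrefixClosed.induction (P := fun W ↦ IsFilled (region
      (fun v _ ↦ v ∈ W) (fun v i _ ↦ v ∈ W ∧ v * FreeGroup.of i ∈ W))) ?_ ?_ hW
  · convert isFilled_fiber 1 using 3
    · simp
    · ext
      simp +contextual
  · intro W u hW hu hp ih
    obtain ⟨x, s, ⟨hx, hx'⟩ | ⟨hx, hx'⟩, he⟩ := hW.exists_edge hu hp
    -- The edge starts at the old coset, so the cylinder is grown directly on the part already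
    -- filled.
    · have := isFilled_strip ih (v := x) (i := s) (fun _ ↦ hx ▸ hp) (fun _ ↦ hx' ▸ hu)
      convert this using 4
      · grind
      · ext
        grind
    -- The edge starts at the new coset `x = u`, and the cylinder maps the old tree into the new
    -- one. It is built separately on the tree over `u` and then glued to the old part along the
    -- tree over the parent.
    · have := isFilled_strip (isFilled_fiber x) (v := x) (i := s) (fun _ ↦ rfl) (fun _ ↦ hone x s)
      refine this.union_of_eq ih (isFilled_fiber u.parent) ?_ ?_
      · ext c
        induction c using cell_cases <;> simp <;> grind
      · ext c
        induction c using cell_cases <;> simp <;> grind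

lemma isFilled_univ : IsFilled Set.univ := by
  have := IsFilled.iUnion_region (J := PrefixClosed (Fin 2))
    (P := fun W v _ ↦ v ∈ W.1) (Q := fun W v i _ ↦ v ∈ W.1 ∧ v * FreeGroup.of i ∈ W.1)
    (fun _ _ h _ _ h' ↦ h h') (fun _ _ h _ _ _ h' ↦ ⟨h h'.1, h h'.2⟩)
    (fun W ↦ isFilled_cosets W.2)
  convert this
  have h1 (v : FreeGroup (Fin 2)) : ∃ W : PrefixClosed (Fin 2), v ∈ W.1 := by
    obtain ⟨W, hW, h⟩ := FreeGroup.exists_isPrefixClosed_mem v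
    exact ⟨⟨W, hW⟩, h⟩
  have h2 (v w : FreeGroup (Fin 2)) : ∃ W : PrefixClosed (Fin 2), v ∈ W.1 ∧ w ∈ W.1 := by
    obtain ⟨W, h⟩ := h1 v
    obtain ⟨W', h'⟩ := h1 w
    exact ⟨⟨W.1 ∪ W'.1, W.2.union W'.2⟩, Finset.mem_union_left _ h, Finset.mem_union_right _ h'⟩
  symm
  rw [Set.eq_univ_iff_forall]
  intro c
  induction c using cell_cases <;> simp only [vert_mem_region, oneCell_inr_mem_region,
    oneCell_inl_mem_region, twoCell_mem_region, h1, h2, and_self]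

/-- The Cayley complex of the presentation is contractible. -/
theorem contractibleSpace_cayleyComplex : ContractibleSpace (CayleyComplex gen relatorF3F2) := by
  refine contractibleSpace_of_isExtensor gen_relator ?_
  convert isFilled_univ.isExtensor
  symm
  rw [Set.eq_univ_iff_forall]
  intro x
  obtain ⟨c, hc⟩ := exists_mem_openCell x
  exact (mem_realize_iff isFilled_univ.1 hc).2 (Set.mem_univ c)

end F3F2

/-! ### Local path-connectedness and universal covers -/

/-- The local homeomorphisms serve as charts with values in X. -/
lemma IsLocalHomeomorph.locallyPathConnectedSpace {E X : Type*} [TopologicalSpace E]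
    [TopologicalSpace X] [LocallyPathConnectedSpace X] {p : E → X} (hp : IsLocalHomeomorph p) :
    LocallyPathConnectedSpace E := by
  let _ : ChartedSpace X E :=
    { atlas := Set.univ
      chartAt := fun e ↦ (hp e).choose
      mem_chart_source := fun e ↦ (hp e).choose_spec.1
      chart_mem_atlas := fun _ ↦ Set.mem_univ _ }
  exact ChartedSpace.locallyPathConnectedSpace X E

instance : LocallyPathConnectedSpace (Metric.closedBall (0 : ℂ) 1) :=
  (convex_closedBall (0 : ℂ) 1).locallyPathConnectedSpace

instance : LocallyPathConnectedSpace unitInterval :=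
  (convex_Icc (0 : ℝ) 1).locallyPathConnectedSpace

instance {S : Type*} : LocallyPathConnectedSpace (Bouquet S) :=
  inferInstanceAs (LocallyPathConnectedSpace (Quot _))

instance {S ι : Type*} [DecidableEq S] (rel : ι → FreeGroup S) :
    LocallyPathConnectedSpace (PresentationComplex rel) :=
  inferInstanceAs (LocallyPathConnectedSpace (Quot _))

/-- Simply connected covering spaces of a locally path-connected space are homeomorphic. -/
lemma IsCoveringMap.nonempty_homeomorph {E E' X : Type*} [TopologicalSpace E] [TopologicalSpace E']
    [TopologicalSpace X] [LocallyPathConnectedSpace X] [SimplyConnectedSpace E]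
    [SimplyConnectedSpace E'] {p : E → X} {p' : E' → X} (hp : IsCoveringMap p)
    (hp' : IsCoveringMap p') {e : E} {e' : E'} (he : p e = p' e') : Nonempty (E ≃ₜ E') := by
  have := hp.isLocalHomeomorph.locallyPathConnectedSpace
  have := hp'.isLocalHomeomorph.locallyPathConnectedSpace
  obtain ⟨f, ⟨hf, hpf⟩, -⟩ := hp'.existsUnique_continuousMap_lifts ⟨p, hp.continuous⟩ e e' he.symm
  obtain ⟨f', ⟨hf', hpf'⟩, -⟩ := hp.existsUnique_continuousMap_lifts ⟨p', hp'.continuous⟩ e' e he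
  have h1 : f' ∘ f = id := by
    refine hp.eq_of_comp_eq (f'.continuous.comp f.continuous) continuous_id ?_ e ?_
    · rw [← Function.comp_assoc, hpf']
      exact hpf
    · rw [Function.comp_apply, hf, hf', id]
  have h2 : f ∘ f' = id := by
    refine hp'.eq_of_comp_eq (f.continuous.comp f'.continuous) continuous_id ?_ e' ?_
    · rw [← Function.comp_assoc, hpf]
      exact hpf'
    · rw [Function.comp_apply, hf', hf, id]
  exact ⟨⟨⟨f, f', congrFun h1, congrFun h2⟩, f.continuous, f'.continuous⟩⟩

theorem mainTheorem12 :
    IsModelOfClassifyingSpace F3F2 complexF3F2 ∧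
      Nonempty (FundamentalGroup complexF3F2 (PresentationComplex.base relatorF3F2) ≃* F3F2) ∧
      ∀ (E : Type*) [TopologicalSpace E] (p : E → complexF3F2),
        IsUniversalCover p → ContractibleSpace E := by
  have hE := F3F2.contractibleSpace_cayleyComplex
  have hq := CayleyComplex.isQuotientCoveringMap_toPresentationComplex F3F2.gen_relator
  refine ⟨⟨_, _, _, _, hE, hq⟩, ?_, fun E _ p ⟨_, hp⟩ ↦ ?_⟩
  · obtain ⟨e, he⟩ := hq.surjective (PresentationComplex.base relatorF3F2)
    -- The covering identifies the fundamental group with the opposite group of G, and inversion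
    -- identifies the latter with G.
    exact ⟨(hq.fundamentalGroupEquiv ⟨e, he⟩).trans (MulEquiv.inv' F3F2).symm⟩
  · obtain ⟨e⟩ : Nonempty E := inferInstance
    obtain ⟨e', he⟩ := hq.surjective (p e)
    obtain ⟨f⟩ := hp.nonempty_homeomorph hq.isCoveringMap he.symm
    exact f.contractibleSpace
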